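/- Let $k$ be a field, $H$ a Hopf algebra over $k$ with bijective antipode $S$, $C$ a left $H$-module coalgebra (so $\Delta(hc)=h_{(1)}c_{(1)}\otimes h_{(2)}c_{(2)}$, $\varepsilon(hc)=\varepsilon(h)\varepsilon(c)$) and $A$ a unital left $H$-module algebra (so $h(ab)=(h_{(1)}a)(h_{(2)}b)$, $h1=\varepsilon(h)1$). Assume that $C$ acts equivariantly on $A$: there is a linear map $C\otimes A\to A$, $c\otimes a\mapsto c\triangleright a$, with $c\triangleright(ab)=(c_{(1)}\triangleright a)(c_{(2)}\triangleright b)$, $c\triangleright 1=\varepsilon(c)1$ and $h(c\triangleright a)=(hc)\triangleright a$. Let $M$ be a right-left stable anti-Yetter–Drinfeld module over $H$: a right $H$-module with a left coaction $m\mapsto m_{\langle-1\rangle}\otimes m_{\langle0\rangle}$ such that $(mh)_{\langle-1\rangle}\otimes(mh)_{\langle0\rangle}=S(h_{(3)})m_{\langle-1\rangle}h_{(1)}\otimes m_{\langle0\rangle}h_{(2)}$ and $m_{\langle0\rangle}m_{\langle-1\rangle}=m$. For a cocyclic $k$-module $X$ (a functor from Connes' cyclic category $\Delta C$ to $k$-modules)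 let $HC^n(X)=\operatorname{Ext}^n_{\Delta C}(k,X)$ be its cyclic cohomology, where $k$ is the constant cocyclic module. Let $C^\bullet_H(C,M)$, $C^\bullet_H(A,M)$ and $C^\bullet(A)$ be the following cocyclic modules; in each, $d_i:C^n\to C^{n+1}$ is given for $0\le i\le n$, the last coface is $d_{n+1}=t\,d_0$, and $s_j:C^{n+1}\to C^n$ is given for $0\le j\le n$. 1. $C^n_H(C,M)=M\otimes_H C^{\otimes n+1}$ ($H$ acting diagonally on $C^{\otimes n+1}$), with $d_i(m\otimes c^0\otimes\cdots\otimes c^n)=m\otimes c^0\otimes\cdots\otimes c^i_{(1)}\otimes c^i_{(2)}\otimes\cdots\otimes c^n$, $s_j(m\otimes c^0\otimes\cdots\otimes c^{n+1})=\varepsilon(c^{j+1})\,m\otimes c^0\otimes\cdots\otimes c^j\otimes c^{j+2}\otimes\cdots\otimes c^{n+1}$ and $t(m\otimes c^0\otimes\cdots\otimes c^n)=m_{\langle0\rangle}\otimes c^1\otimes\cdots\otimes c^n\otimes m_{\langle-1\rangle}c^0$. 2. $C^n_H(A,M)=\operatorname{Hom}_k(M\otimes_H A^{\otimes n+1},k)$,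 with $(d_i\varphi)(m\otimes a_0\otimes\cdots\otimes a_{n+1})=\varphi(m\otimes a_0\otimes\cdots\otimes a_ia_{i+1}\otimes\cdots\otimes a_{n+1})$, $(s_j\varphi)(m\otimes a_0\otimes\cdots\otimes a_n)=\varphi(m\otimes a_0\otimes\cdots\otimes a_j\otimes1\otimes a_{j+1}\otimes\cdots\otimes a_n)$ and $(t\varphi)(m\otimes a_0\otimes\cdots\otimes a_n)=\varphi(m_{\langle0\rangle}\otimes S^{-1}(m_{\langle-1\rangle})a_n\otimes a_0\otimes\cdots\otimes a_{n-1})$. 3. $C^n(A)=\operatorname{Hom}_k(A^{\otimes n+1},k)$, with the same formulas without $M$ (so $(t\varphi)(a_0\otimes\cdots\otimes a_n)=\varphi(a_n\otimes a_0\otimes\cdots\otimes a_{n-1})$). Write $HC^*_H(C,M)$, $HC^*_H(A,M)$ and $HC^*(A)$ (the ordinary cyclic cohomology of $A$) for their cyclic cohomologies. Then there is a morphism of cocyclic modules on the diagonal (levelwise) tensor product $$\Psi:\operatorname{diag}\bigl(C^\bullet_H(C,M)\otimes C^\bullet_H(A,M)\bigr)\to C^\bullet(A),$$ $$\Psi_n\bigl((m\otimes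 c^0\otimes\cdots\otimes c^n)\otimes\varphi\bigr)(a_0\otimes\cdots\otimes a_n)=\varphi\bigl(m\otimes(c^0\triangleright a_0)\otimes\cdots\otimes(c^n\triangleright a_n)\bigr),$$ and, for all $p,q\ge0$, the assignment $\alpha\otimes\beta\mapsto\Psi_*(\alpha\times\beta)$ is a well-defined $k$-linear pairing $$HC^p_H(C,M)\otimes HC^q_H(A,M)\to HC^{p+q}(A),$$ where $\times:HC^p(X)\otimes HC^q(Y)\to HC^{p+q}(\operatorname{diag}(X\otimes Y))$ is the external product: the Yoneda product of $\alpha\in\operatorname{Ext}^p(k,X)$ with the image of $\beta$ under the exact functor $X\otimes-$ in $\operatorname{Ext}^q(X,X\otimes Y)$. -/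

import Mathlib

open CategoryTheory Limits MonoidalCategory
open scoped TensorProduct

universe u

namespace HopfCyclic

set_option linter.unusedSectionVars false

section Sweedler

open Coalgebra

/-- The Sweedler sum `∑ f(c₍₁₎, c₍₂₎)` over `Δ(c) = ∑ c₍₁₎ ⊗ c₍₂₎`. It is used for bilinear `f`
only, where it does not depend on the chosen expression of `Δ(c)`. -/
noncomputable def sweedler (k : Type u) [Field k] {C W : Type u} [AddCommGroup C] [Module k C]
    [Coalgebra k C] [AddCommGroup W] (c : C) (f : C → C → W) : W :=
  ∑ i ∈ (ℛ k c).index, f ((ℛ k c).left i) ((ℛ k c).right i)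

variable {k : Type u} [Field k] {C W W' : Type u} [AddCommGroup C] [Module k C] [Coalgebra k C]
  [AddCommGroup W] [Module k W] [AddCommGroup W'] [Module k W']

/-- Bilinearity of an unbundled map. -/
structure IsBil (k : Type u) [Field k] {C D W : Type u} [AddCommGroup C] [Module k C]
    [AddCommGroup D] [Module k D] [AddCommGroup W] [Module k W] (f : C → D → W) : Prop where
  add_left : ∀ a b c, f (a + b) c = f a c + f b c
  smul_left : ∀ (r : k) a c, f (r • a) c = r • f a c
  add_right : ∀ a b c, f a (b + c) = f a b + f a c
  smul_right : ∀ (r : k) a c, f a (r • c) = r • f a c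

theorem sweedler_eq_lift (B : C →ₗ[k] C →ₗ[k] W) (c : C) :
    sweedler k c (fun a b => B a b) = TensorProduct.lift B (comul c) := by
  rw [← (ℛ k c).eq]; simp [sweedler]

theorem sweedler_add {f : C → C → W} (hf : IsBil k f) (a b : C) :
    sweedler k (a + b) f = sweedler k a f + sweedler k b f := by
  have := sweedler_eq_lift (LinearMap.mk₂ k f hf.1 hf.2 hf.3 hf.4)
  simp only [LinearMap.mk₂_apply] at this
  simp [this]

theorem sweedler_smul {f : C → C → W} (hf : IsBil k f) (r : k) (b : C) :
    sweedler k (r • b) f = r • sweedler k b f := by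
  have := sweedler_eq_lift (LinearMap.mk₂ k f hf.1 hf.2 hf.3 hf.4)
  simp only [LinearMap.mk₂_apply] at this
  simp [this]

theorem sweedler_map (g : W →ₗ[k] W') (c : C) (f : C → C → W) :
    g (sweedler k c f) = sweedler k c (fun a b => g (f a b)) := by
  simp [sweedler]

theorem sweedler_apply (c : C) (f : C → C → (W →ₗ[k] W')) (x : W) :
    (sweedler k c f) x = sweedler k c (fun a b => f a b x) := by
  simp [sweedler]

theorem sweedler_smul_right (r : k) (c : C) (f : C → C → W) :
    sweedler k c (fun a b => r • f a b) = r • sweedler k c f := by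
  simp [sweedler, Finset.smul_sum]

theorem sweedler_add_right (c : C) (f g : C → C → W) :
    sweedler k c (fun a b => f a b + g a b) = sweedler k c f + sweedler k c g := by
  simp [sweedler, Finset.sum_add_distrib]

theorem sweedler_sub_right (c : C) (f g : C → C → W) :
    sweedler k c (fun a b => f a b - g a b) = sweedler k c f - sweedler k c g := by
  simp [sweedler, Finset.sum_sub_distrib]

theorem sweedler_counit_left (g : C →ₗ[k] W) (c : C) :
    sweedler k c (fun a b => counit (R := k) a • g b) = g c := by
  have := congrArg g (sum_counit_smul (R := k) (ℛ k c))
  simpa [sweedler] using this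

theorem sweedler_counit_right (g : C →ₗ[k] W) (c : C) :
    sweedler k c (fun a b => counit (R := k) b • g a) = g c := by
  have h : sweedler k c (fun a b => counit (R := k) b • a) = c := by
    have h := congrArg (TensorProduct.rid k C) (sum_tmul_counit_eq (R := k) (ℛ k c))
    simp only [map_sum, TensorProduct.rid_tmul, one_smul] at h
    exact h
  conv_rhs => rw [← h]
  rw [sweedler_map]; simp

/-- Trilinearity of an unbundled map. -/
structure IsTri (k : Type u) [Field k] {C W : Type u} [AddCommGroup C] [Module k C]
    [AddCommGroup W] [Module k W] (f : C → C → C → W) : Prop where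
  add₁ : ∀ a b c d, f (a + b) c d = f a c d + f b c d
  smul₁ : ∀ (r : k) a b c, f (r • a) b c = r • f a b c
  add₂ : ∀ a b c d, f a (b + c) d = f a b d + f a c d
  smul₂ : ∀ (r : k) a b c, f a (r • b) c = r • f a b c
  add₃ : ∀ a b c d, f a b (c + d) = f a b c + f a b d
  smul₃ : ∀ (r : k) a b c, f a b (r • c) = r • f a b c

theorem IsTri.exists {f : C → C → C → W} (hf : IsTri k f) :
    ∃ F : C ⊗[k] (C ⊗[k] C) →ₗ[k] W, ∀ a b c, F (a ⊗ₜ (b ⊗ₜ c)) = f a b c := by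
  let G : C →ₗ[k] (C ⊗[k] C →ₗ[k] W) :=
    { toFun := fun a => TensorProduct.lift
        (LinearMap.mk₂ k (f a) (hf.add₂ a) (fun r b c => hf.smul₂ r a b c) (hf.add₃ a)
          (fun r b c => hf.smul₃ r a b c))
      map_add' := fun a b => by
        apply TensorProduct.ext'; intro x y; simp [hf.add₁]
      map_smul' := fun r a => by
        apply TensorProduct.ext'; intro x y; simp [hf.smul₁] }
  exact ⟨TensorProduct.lift G, fun a b c => by simp [G]⟩

theorem sweedler_coassoc {f : C → C → C → W} (hf : IsTri k f) (c : C) :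
    sweedler k c (fun a b => sweedler k b (fun b c => f a b c)) =
      sweedler k c (fun a b => sweedler k a (fun a' b' => f a' b' b)) := by
  obtain ⟨F, hF⟩ := hf.exists
  have h := congrArg F (coassoc_apply (R := k) c)
  rw [← (ℛ k c).eq] at h
  simp only [map_sum, LinearMap.rTensor_tmul, LinearMap.lTensor_tmul] at h
  simp only [sweedler, ← hF]
  have h1 : ∀ x y : C, F (TensorProduct.assoc k C C C (comul x ⊗ₜ[k] y)) =
      ∑ i ∈ (ℛ k x).index, F ((ℛ k x).left i ⊗ₜ ((ℛ k x).right i ⊗ₜ y)) := by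
    intro x y
    conv_lhs => rw [← (ℛ k x).eq]
    simp [TensorProduct.sum_tmul]
  have h2 : ∀ x y : C, F (x ⊗ₜ[k] comul y) =
      ∑ i ∈ (ℛ k y).index, F (x ⊗ₜ ((ℛ k y).left i ⊗ₜ (ℛ k y).right i)) := by
    intro x y
    conv_lhs => rw [← (ℛ k y).eq]
    simp [TensorProduct.tmul_sum]
  simp only [h1, h2] at h
  exact h.symm

theorem IsTri.inner_right {f : C → C → C → W} (hf : IsTri k f) :
    IsBil k (fun a b => sweedler k b (fun b c => f a b c)) where
  add_left a b c := by simp [hf.add₁, sweedler_add_right]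
  smul_left r a c := by simp [hf.smul₁, sweedler_smul_right]
  add_right a b c := sweedler_add ⟨hf.add₂ a, fun r b c => hf.smul₂ r a b c, hf.add₃ a,
    fun r b c => hf.smul₃ r a b c⟩ b c
  smul_right r a c := sweedler_smul ⟨hf.add₂ a, fun r b c => hf.smul₂ r a b c, hf.add₃ a,
    fun r b c => hf.smul₃ r a b c⟩ r c

/-- Reading off a Sweedler sum from any expression of the coproduct. -/
theorem sweedler_of_comul {f : C → C → W} (F : C ⊗[k] C →ₗ[k] W)
    (hF : ∀ a b, F (a ⊗ₜ b) = f a b) (c : C) : sweedler k c f = F (comul c) := by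
  conv_rhs => rw [← (ℛ k c).eq]
  simp [sweedler, hF]

end Sweedler

/-! ### Tensor powers -/

section TensorPower

variable {k : Type u} [Field k]

/-- The tensor power `V^{⊗ n} = V ⊗ (V ⊗ (⋯ ⊗ k))`. -/
noncomputable def TPow (k : Type u) [Field k] (V : Type u) [AddCommGroup V] [Module k V] :
    ℕ → ModuleCat.{u} k
  | 0 => ModuleCat.of k k
  | n + 1 => ModuleCat.of k (V ⊗[k] TPow k V n)

namespace TPow

variable {V W : Type u} [AddCommGroup V] [Module k V] [AddCommGroup W] [Module k W]

/-- The unit of `V^{⊗ 0} = k`. -/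
def nil : TPow k V 0 := (1 : k)

/-- `v ⊗ x`, for `x` in `V^{⊗ n}`. -/
noncomputable def cons {n : ℕ} : V →ₗ[k] TPow k V n →ₗ[k] TPow k V (n + 1) :=
  TensorProduct.mk k V (TPow k V n)

/-- The pure tensor `f 0 ⊗ ⋯ ⊗ f (n-1)`. -/
noncomputable def pure : {n : ℕ} → (Fin n → V) → TPow k V n
  | 0, _ => nil
  | _ + 1, f => cons (f 0) (pure (Fin.tail f))

/-- The linear map out of `V^{⊗ 0} = k` with a given value at `1`. -/
noncomputable def elim0 (w : W) : TPow k V 0 →ₗ[k] W := LinearMap.toSpanSingleton k W w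

/-- The linear map out of `V^{⊗ (n+1)} = V ⊗ V^{⊗ n}` given by a bilinear map. -/
noncomputable def elim {n : ℕ} (B : V →ₗ[k] TPow k V n →ₗ[k] W) : TPow k V (n + 1) →ₗ[k] W :=
  TensorProduct.lift B

@[simp] theorem elim0_nil (w : W) : elim0 (V := V) w (nil : TPow k V 0) = w :=
  one_smul k w

@[simp] theorem elim_cons {n : ℕ} (B : V →ₗ[k] TPow k V n →ₗ[k] W) (v : V) (x : TPow k V n) :
    elim B (cons v x) = B v x := TensorProduct.lift.tmul v x

theorem ext0 {f g : TPow k V 0 →ₗ[k] W} (h : f nil = g nil) : f = g :=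
  LinearMap.ext_ring h

theorem ext_cons {n : ℕ} {f g : TPow k V (n + 1) →ₗ[k] W}
    (h : ∀ v x, f (cons v x) = g (cons v x)) : f = g :=
  TensorProduct.ext' h

theorem pure_zero (f : Fin 0 → V) : (pure f : TPow k V 0) = nil := rfl

theorem pure_succ {n : ℕ} (f : Fin (n + 1) → V) :
    (pure f : TPow k V (n + 1)) = cons (f 0) (pure (Fin.tail f)) := rfl

theorem ext_pure : {n : ℕ} → {f g : TPow k V n →ₗ[k] W} → (∀ a, f (pure a) = g (pure a)) → f = g
  | 0, _, _, h => ext0 (h Fin.elim0)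
  | n + 1, f, g, h => ext_cons fun v x => by
      have : f ∘ₗ cons v = g ∘ₗ cons v := ext_pure fun a => by
        simpa [pure_succ] using h (Fin.cons v a)
      exact LinearMap.congr_fun this x

/-- `v₀ ⊗ x ↦ f(v₀) ⊗ x`. -/
noncomputable def head {n : ℕ} : (V →ₗ[k] V) →ₗ[k] TPow k V (n + 1) →ₗ[k] TPow k V (n + 1) :=
  LinearMap.rTensorHom (TPow k V n)

/-- `v₀ ⊗ x ↦ v₀ ⊗ f(x)`. -/
noncomputable def tail {n m : ℕ} :
    (TPow k V n →ₗ[k] TPow k V m) →ₗ[k] TPow k V (n + 1) →ₗ[k] TPow k V (m + 1) :=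
  LinearMap.lTensorHom V

@[simp] theorem head_cons {n : ℕ} (f : V →ₗ[k] V) (v : V) (x : TPow k V n) :
    head f (cons v x) = cons (f v) x := rfl

@[simp] theorem tail_cons {n m : ℕ} (f : TPow k V n →ₗ[k] TPow k V m) (v : V) (x : TPow k V n) :
    tail f (cons v x) = cons v (f x) := rfl

/-- `v₀ ⊗ v₁ ⊗ x ↦ v₁ ⊗ v₀ ⊗ x`. -/
noncomputable def swap (n : ℕ) : TPow k V (n + 2) →ₗ[k] TPow k V (n + 2) :=
  (TensorProduct.leftComm k V V (TPow k V n)).toLinearMap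

@[simp] theorem swap_cons {n : ℕ} (v w : V) (x : TPow k V n) :
    swap n (cons v (cons w x)) = cons w (cons v x) := rfl

/-- The rotation `v₀ ⊗ v₁ ⊗ ⋯ ⊗ v_n ↦ v₁ ⊗ ⋯ ⊗ v_n ⊗ v₀`. -/
noncomputable def rotL : (n : ℕ) → TPow k V (n + 1) →ₗ[k] TPow k V (n + 1)
  | 0 => LinearMap.id
  | n + 1 => tail (rotL n) ∘ₗ swap n

/-- The rotation `v₀ ⊗ v₁ ⊗ ⋯ ⊗ v_n ↦ v_n ⊗ v₀ ⊗ ⋯ ⊗ v_{n-1}`. -/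
noncomputable def rotR : (n : ℕ) → TPow k V (n + 1) →ₗ[k] TPow k V (n + 1)
  | 0 => LinearMap.id
  | n + 1 => swap n ∘ₗ tail (rotR n)

@[simp] theorem rotL_zero (x : TPow k V 1) : rotL 0 x = x := rfl

@[simp] theorem rotL_cons {n : ℕ} (v w : V) (x : TPow k V n) :
    rotL (n + 1) (cons v (cons w x)) = cons w (rotL n (cons v x)) := rfl

theorem rotR_succ_cons {n : ℕ} (v : V) (x : TPow k V (n + 1)) :
    rotR (n + 1) (cons v x) = swap n (cons v (rotR n x)) := rfl

theorem swap_swap (n : ℕ) : swap n ∘ₗ swap n = (LinearMap.id : TPow k V (n + 2) →ₗ[k] _) := by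
  refine ext_cons fun v x => ?_
  have : (swap n ∘ₗ swap n) ∘ₗ cons v = (cons v : TPow k V (n + 1) →ₗ[k] _) :=
    ext_cons fun w x => rfl
  exact LinearMap.congr_fun this x

theorem ext_cons₂ {n : ℕ} {f g : TPow k V (n + 2) →ₗ[k] W}
    (h : ∀ v w x, f (cons v (cons w x)) = g (cons v (cons w x))) : f = g := by
  refine ext_cons fun v x => ?_
  have : f ∘ₗ cons v = g ∘ₗ cons v := ext_cons fun w x => h v w x
  exact LinearMap.congr_fun this x

theorem tail_comp {n m l : ℕ} (f : TPow k V m →ₗ[k] TPow k V l) (g : TPow k V n →ₗ[k] TPow k V m) :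
    tail f ∘ₗ tail g = tail (f ∘ₗ g) := ext_cons fun _ _ => rfl

theorem tail_id {n : ℕ} : tail (LinearMap.id : TPow k V n →ₗ[k] _) = LinearMap.id :=
  ext_cons fun _ _ => rfl

theorem rotL_rotR : (n : ℕ) → rotL n ∘ₗ rotR n = (LinearMap.id : TPow k V (n + 1) →ₗ[k] _)
  | 0 => rfl
  | n + 1 => by
      ext x
      have h1 : ∀ y, swap n (swap n y) = (y : TPow k V (n + 2)) := LinearMap.congr_fun (swap_swap n)
      have h2 : ∀ y, tail (rotL n) (tail (rotR n) y) = (y : TPow k V (n + 2)) := fun y => by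
        rw [← LinearMap.comp_apply, tail_comp, rotL_rotR n, tail_id, LinearMap.id_apply]
      simp only [rotL, rotR, LinearMap.comp_apply, h1, h2, LinearMap.id_apply]

theorem rotR_rotL : (n : ℕ) → rotR n ∘ₗ rotL n = (LinearMap.id : TPow k V (n + 1) →ₗ[k] _)
  | 0 => rfl
  | n + 1 => by
      ext x
      have h1 : ∀ y, swap n (swap n y) = (y : TPow k V (n + 2)) := LinearMap.congr_fun (swap_swap n)
      have h2 : ∀ y, tail (rotR n) (tail (rotL n) y) = (y : TPow k V (n + 2)) := fun y => by
        rw [← LinearMap.comp_apply, tail_comp, rotR_rotL n, tail_id, LinearMap.id_apply]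
      simp only [rotL, rotR, LinearMap.comp_apply, h1, h2, LinearMap.id_apply]

theorem rotL_pure : (n : ℕ) → (f : Fin (n + 1) → V) →
    rotL n (pure f : TPow k V (n + 1)) = pure (fun i => f (i + 1))
  | 0, f => by
      have : (fun i : Fin 1 => f (i + 1)) = f := by
        funext i; rw [Subsingleton.elim (i + 1) i]
      rw [this]; rfl
  | n + 1, f => by
      let g : Fin (n + 1) → V := Fin.cons (f 0) (Fin.tail (Fin.tail f))
      have key : rotL (n + 1) (pure f : TPow k V (n + 2)) = cons (f 1) (rotL n (pure g)) := rfl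
      rw [key, rotL_pure n g, pure_succ (fun i : Fin (n + 2) => f (i + 1))]
      have h1 : f (0 + 1) = f 1 := by simp
      have h2 : (fun i => g (i + 1)) = Fin.tail (fun i : Fin (n + 2) => f (i + 1)) := by
        funext i
        refine Fin.lastCases ?_ (fun j => ?_) i
        · simp [Fin.tail, g]
        · simp only [Fin.tail, g, Fin.cons_succ, Fin.coeSucc_eq_succ, Fin.succ_castSucc]
      rw [h1, h2]

theorem rotL_pow_pure {n : ℕ} (f : Fin (n + 1) → V) (j : ℕ) :
    (rotL n ^ j) (pure f : TPow k V (n + 1)) = pure (fun i => f (i + Fin.ofNat (n + 1) j)) := by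
  induction j generalizing f with
  | zero => simp
  | succ j ih =>
    rw [pow_succ, Module.End.mul_apply, rotL_pure, ih]
    congr 1; funext i; congr 1; apply Fin.ext; simp [Fin.val_add, add_assoc]

theorem rotL_pow_self (n : ℕ) : (rotL n ^ (n + 1) : Module.End k (TPow k V (n + 1))) = 1 :=
  ext_pure fun f => by
    rw [rotL_pow_pure, Module.End.one_apply]
    congr 1; funext i; congr 1; apply Fin.ext; simp [Fin.val_add, Nat.mod_eq_of_lt i.isLt]

/-- The map `f` applied to the `p`-th tensor factor, for `p < n`. -/
noncomputable def slot : (n p : ℕ) → (V →ₗ[k] V) →ₗ[k] (TPow k V n →ₗ[k] TPow k V n)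
  | 0, _ => 0
  | _ + 1, 0 => head
  | n + 1, p + 1 => tail ∘ₗ slot n p

theorem slot_succ_cons {n p : ℕ} (f : V →ₗ[k] V) (v : V) (x : TPow k V n) :
    slot (n + 1) (p + 1) f (cons v x) = cons v (slot n p f x) := rfl

theorem slot_zero_cons {n : ℕ} (f : V →ₗ[k] V) (v : V) (x : TPow k V n) :
    slot (n + 1) 0 f (cons v x) = cons (f v) x := rfl

theorem slot_rotL : (n p : ℕ) → p < n → (f : V →ₗ[k] V) →
    slot (n + 1) p f ∘ₗ rotL n = rotL n ∘ₗ slot (n + 1) (p + 1) f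
  | n + 1, 0, _, f => ext_cons₂ fun v w x => rfl
  | n + 1, p + 1, h, f => ext_cons₂ fun v w x => by
      have := LinearMap.congr_fun (slot_rotL n p (by omega) f) (cons v x)
      simp only [LinearMap.comp_apply, slot_succ_cons, rotL_cons] at this ⊢
      rw [this]

/-! The structure maps `split` (from a coproduct), `del` (from a counit), `merge` (from a product)
and `ins` (from a unit) on tensor powers. The index counts positions from `0`; where it is out of
range the maps are `0`, and these values are not used. -/

end TPow

section Coalg

open TPow Coalgebra

variable {C : Type u} [AddCommGroup C] [Module k C] [Coalgebra k C]

/-- `c⁰ ⊗ ⋯ ⊗ c^{n-1} ↦ c⁰ ⊗ ⋯ ⊗ cⁱ₍₁₎ ⊗ cⁱ₍₂₎ ⊗ ⋯ ⊗ c^{n-1}`, for `i < n`. -/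
noncomputable def split : (n i : ℕ) → TPow k C n →ₗ[k] TPow k C (n + 1)
  | 0, _ => 0
  | n + 1, 0 => (TensorProduct.assoc k C C (TPow k C n)).toLinearMap ∘ₗ
      LinearMap.rTensor (TPow k C n) (comul (R := k) (A := C))
  | n + 1, i + 1 => tail (split n i)

/-- `c⁰ ⊗ ⋯ ⊗ cⁿ ↦ ε(cⁱ) c⁰ ⊗ ⋯ ⊗ c^{i-1} ⊗ c^{i+1} ⊗ ⋯ ⊗ cⁿ`, for `i ≤ n`. -/
noncomputable def del : (n i : ℕ) → TPow k C (n + 1) →ₗ[k] TPow k C n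
  | n, 0 => (TensorProduct.lid k (TPow k C n)).toLinearMap ∘ₗ
      LinearMap.rTensor (TPow k C n) (counit (R := k) (A := C))
  | 0, _ + 1 => 0
  | n + 1, i + 1 => tail (del n i)

theorem split_zero_cons {n : ℕ} (c : C) (x : TPow k C n) :
    split (n + 1) 0 (cons c x) = sweedler k c (fun a b => cons a (cons b x)) := by
  let F : C ⊗[k] C →ₗ[k] TPow k C (n + 2) :=
    (TensorProduct.assoc k C C (TPow k C n)).toLinearMap ∘ₗ (TensorProduct.mk k _ _).flip x
  have hF : ∀ a b, F (a ⊗ₜ b) = cons a (cons b x) := fun a b => rfl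
  rw [sweedler_of_comul F hF]
  rfl

theorem split_succ_cons {n i : ℕ} (c : C) (x : TPow k C n) :
    split (n + 1) (i + 1) (cons c x) = cons c (split n i x) := rfl

theorem del_zero_cons {n : ℕ} (c : C) (x : TPow k C n) :
    del n 0 (cons c x) = counit (R := k) c • x := by cases n <;> rfl

theorem del_succ_cons {n i : ℕ} (c : C) (x : TPow k C (n + 1)) :
    del (n + 1) (i + 1) (cons c x) = cons c (del n i x) := rfl

theorem split_split : (n i j : ℕ) → i ≤ j → j < n →
    split (k := k) (C := C) (n + 1) (j + 1) ∘ₗ split n i = split (n + 1) i ∘ₗ split n j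
  | n + 1, 0, 0, _, _ => ext_cons fun c x => by
      simp only [LinearMap.comp_apply, split_zero_cons, sweedler_map, split_succ_cons]
      exact sweedler_coassoc (f := fun a b c => cons a (cons b (cons c x)))
        ⟨by simp, by simp, by simp, by simp, by simp, by simp⟩ c
  | n + 1, 0, j + 1, _, _ => ext_cons fun c x => by
      simp only [LinearMap.comp_apply, split_zero_cons, sweedler_map, split_succ_cons]
  | n + 1, i + 1, j + 1, h, h' => ext_cons fun c x => by
      have := LinearMap.congr_fun (split_split n i j (by omega) (by omega)) x
      simp only [LinearMap.comp_apply, split_succ_cons] at this ⊢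
      rw [this]

theorem del_del : (n i j : ℕ) → i ≤ j → j ≤ n →
    del (k := k) (C := C) n j ∘ₗ del (n + 1) i = del n i ∘ₗ del (n + 1) (j + 1)
  | n, 0, j, _, _ => ext_cons fun c x => by
      simp [del_zero_cons, del_succ_cons]
  | 0, i + 1, j, h, h' => by omega
  | n + 1, i + 1, j + 1, h, h' => ext_cons fun c x => by
      have := LinearMap.congr_fun (del_del n i j (by omega) (by omega)) x
      simp only [LinearMap.comp_apply, del_succ_cons] at this ⊢
      rw [this]

theorem del_split_lt : (n i j : ℕ) → i < j → j ≤ n →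
    del (k := k) (C := C) (n + 1) (j + 1) ∘ₗ split (n + 1) i = split n i ∘ₗ del n j
  | 0, i, j, h, h' => by omega
  | n + 1, 0, j + 1, _, _ => ext_cons fun c x => by
      simp only [LinearMap.comp_apply, split_zero_cons, sweedler_map, del_succ_cons]
  | n + 1, i + 1, j + 1, h, h' => ext_cons fun c x => by
      have := LinearMap.congr_fun (del_split_lt n i j (by omega) (by omega)) x
      simp only [LinearMap.comp_apply, split_succ_cons, del_succ_cons] at this ⊢
      rw [this]

theorem del_split_succ : (n i : ℕ) → i < n →
    del (k := k) (C := C) n (i + 1) ∘ₗ split n i = LinearMap.id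
  | n + 1, 0, _ => ext_cons fun c x => by
      simp only [LinearMap.comp_apply, split_zero_cons, sweedler_map, del_succ_cons, del_zero_cons,
        map_smul, LinearMap.id_apply]
      exact sweedler_counit_right (cons.flip x) c
  | n + 1, i + 1, h => ext_cons fun c x => by
      have := LinearMap.congr_fun (del_split_succ n i (by omega)) x
      simp only [LinearMap.comp_apply, split_succ_cons, del_succ_cons, LinearMap.id_apply] at this ⊢
      rw [this]

theorem del_split_self : (n i : ℕ) → i < n →
    del (k := k) (C := C) n i ∘ₗ split n i = LinearMap.id
  | n + 1, 0, _ => ext_cons fun c x => by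
      simp only [LinearMap.comp_apply, split_zero_cons, sweedler_map, del_zero_cons,
        LinearMap.id_apply]
      exact sweedler_counit_left (cons.flip x) c
  | n + 1, i + 1, h => ext_cons fun c x => by
      have := LinearMap.congr_fun (del_split_self n i (by omega)) x
      simp only [LinearMap.comp_apply, split_succ_cons, del_succ_cons, LinearMap.id_apply] at this ⊢
      rw [this]

theorem del_split_gt : (n i j : ℕ) → j ≤ i → i < n →
    del (k := k) (C := C) (n + 1) j ∘ₗ split (n + 1) (i + 1) = split n i ∘ₗ del n j
  | 0, i, j + 1, h, h' => by omega
  | n, i, 0, _, _ => ext_cons fun c x => by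
      simp [split_succ_cons, del_zero_cons]
  | n + 1, i + 1, j + 1, h, h' => ext_cons fun c x => by
      have := LinearMap.congr_fun (del_split_gt n i j (by omega) (by omega)) x
      simp only [LinearMap.comp_apply, split_succ_cons, del_succ_cons] at this ⊢
      rw [this]

theorem rotL_split : (n i : ℕ) → i < n →
    rotL (n + 1) ∘ₗ split (k := k) (C := C) (n + 1) (i + 1) = split (n + 1) i ∘ₗ rotL n
  | n + 1, 0, _ => ext_cons₂ fun c d x => by
      simp only [LinearMap.comp_apply, split_zero_cons, sweedler_map, split_succ_cons, rotL_cons]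
  | n + 1, i + 1, h => ext_cons₂ fun c d x => by
      have := LinearMap.congr_fun (rotL_split n i (by omega)) (cons c x)
      simp only [LinearMap.comp_apply, split_succ_cons, rotL_cons] at this ⊢
      rw [this]

theorem rotL_del : (n i : ℕ) → i ≤ n →
    rotL n ∘ₗ del (k := k) (C := C) (n + 1) (i + 1) = del (n + 1) i ∘ₗ rotL (n + 1)
  | n, 0, _ => ext_cons₂ fun c d x => by
      simp [del_succ_cons, del_zero_cons]
  | 0, i + 1, h => by omega
  | n + 1, i + 1, h => ext_cons₂ fun c d x => by
      have h1 : ∃ y : TPow k C (n+1), y = x := ⟨x, rfl⟩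
      have := LinearMap.congr_fun (rotL_del n i (by omega)) (cons c x)
      simp only [LinearMap.comp_apply, del_succ_cons, rotL_cons] at this ⊢
      rw [this]

/-- Deleting the last factor after a rotation. -/
theorem del_last_rotL : (n : ℕ) → (c : C) → (x : TPow k C n) →
    del n n (rotL n (cons c x)) = counit (R := k) c • x
  | 0, c, x => rfl
  | n + 1, c, x => by
      have : (del (n + 1) (n + 1) ∘ₗ rotL (n + 1)) ∘ₗ cons c = counit (R := k) c •
          (LinearMap.id : TPow k C (n + 1) →ₗ[k] _) := ext_cons fun d x => by
        simp [del_succ_cons, del_last_rotL n]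
      exact LinearMap.congr_fun this x

end Coalg

section Alg

open TPow

variable {A : Type u} [Ring A] [Algebra k A]

/-- `a₀ ⊗ ⋯ ⊗ a_{n+1} ↦ a₀ ⊗ ⋯ ⊗ aᵢ aᵢ₊₁ ⊗ ⋯ ⊗ a_{n+1}`, for `i ≤ n`. -/
noncomputable def merge : (n i : ℕ) → TPow k A (n + 2) →ₗ[k] TPow k A (n + 1)
  | n, 0 => LinearMap.rTensor (TPow k A n) (LinearMap.mul' k A) ∘ₗ
      (TensorProduct.assoc k A A (TPow k A n)).symm.toLinearMap
  | 0, _ + 1 => 0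
  | n + 1, i + 1 => tail (merge n i)

/-- `a₀ ⊗ ⋯ ⊗ a_{n-1} ↦ a₀ ⊗ ⋯ ⊗ a_{i-1} ⊗ 1 ⊗ aᵢ ⊗ ⋯ ⊗ a_{n-1}`, for `i ≤ n`. -/
noncomputable def ins : (n i : ℕ) → TPow k A n →ₗ[k] TPow k A (n + 1)
  | _, 0 => cons 1
  | 0, _ + 1 => 0
  | n + 1, i + 1 => tail (ins n i)

theorem merge_zero_cons {n : ℕ} (a b : A) (x : TPow k A n) :
    merge n 0 (cons a (cons b x)) = cons (a * b) x := by cases n <;> rfl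

theorem merge_succ_cons {n i : ℕ} (a : A) (x : TPow k A (n + 2)) :
    merge (n + 1) (i + 1) (cons a x) = cons a (merge n i x) := rfl

theorem ins_zero {n : ℕ} (x : TPow k A n) : ins n 0 x = cons 1 x := by cases n <;> rfl

theorem ins_succ_cons {n i : ℕ} (a : A) (x : TPow k A n) :
    ins (n + 1) (i + 1) (cons a x) = cons a (ins n i x) := rfl

theorem ext_cons₃ {n : ℕ} {V W : Type u} [AddCommGroup V] [Module k V] [AddCommGroup W] [Module k W]
    {f g : TPow k V (n + 3) →ₗ[k] W}
    (h : ∀ u v w x, f (cons u (cons v (cons w x))) = g (cons u (cons v (cons w x)))) : f = g := by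
  refine ext_cons fun v x => ?_
  have : f ∘ₗ cons v = g ∘ₗ cons v := ext_cons₂ fun w x => h v w x
  exact LinearMap.congr_fun this x

theorem merge_merge : (n i j : ℕ) → i ≤ j → j ≤ n →
    merge (k := k) (A := A) n i ∘ₗ merge (n + 1) (j + 1) = merge n j ∘ₗ merge (n + 1) i
  | n, 0, 0, _, _ => ext_cons₃ fun a b c x => by
      simp [merge_zero_cons, merge_succ_cons, mul_assoc]
  | n + 1, 0, j + 1, _, _ => ext_cons₂ fun a b x => by
      simp [merge_zero_cons, merge_succ_cons]
  | 0, i + 1, j, h, h' => by omega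
  | n + 1, i + 1, j + 1, h, h' => ext_cons fun c x => by
      have := LinearMap.congr_fun (merge_merge n i j (by omega) (by omega)) x
      simp only [LinearMap.comp_apply, merge_succ_cons] at this ⊢
      rw [this]

theorem ins_ins : (n i j : ℕ) → i ≤ j → j ≤ n →
    ins (k := k) (A := A) (n + 1) i ∘ₗ ins n j = ins (n + 1) (j + 1) ∘ₗ ins n i
  | n, 0, j, _, _ => by
      ext x; simp [ins_zero, ins_succ_cons]
  | 0, i + 1, j, h, h' => by omega
  | n + 1, i + 1, j + 1, h, h' => ext_cons fun c x => by
      have := LinearMap.congr_fun (ins_ins n i j (by omega) (by omega)) x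
      simp only [LinearMap.comp_apply, ins_succ_cons] at this ⊢
      rw [this]

theorem merge_ins_lt : (n i j : ℕ) → i < j → j ≤ n + 1 →
    merge (k := k) (A := A) (n + 1) i ∘ₗ ins (n + 2) (j + 1) = ins (n + 1) j ∘ₗ merge n i
  | n, 0, j + 1, _, _ => ext_cons₂ fun a b x => by
      simp [merge_zero_cons, ins_succ_cons]
  | 0, i + 1, j, h, h' => by omega
  | n + 1, i + 1, j + 1, h, h' => ext_cons fun c x => by
      have := LinearMap.congr_fun (merge_ins_lt n i j (by omega) (by omega)) x
      simp only [LinearMap.comp_apply, ins_succ_cons, merge_succ_cons] at this ⊢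
      rw [this]

theorem merge_ins_succ : (n i : ℕ) → i ≤ n →
    merge (k := k) (A := A) n i ∘ₗ ins (n + 1) (i + 1) = LinearMap.id
  | n, 0, _ => ext_cons fun a x => by
      simp [merge_zero_cons, ins_succ_cons, ins_zero]
  | 0, i + 1, h => by omega
  | n + 1, i + 1, h => ext_cons fun c x => by
      have := LinearMap.congr_fun (merge_ins_succ n i (by omega)) x
      simp only [LinearMap.comp_apply, ins_succ_cons, merge_succ_cons, LinearMap.id_apply] at this ⊢
      rw [this]

theorem merge_ins_self : (n i : ℕ) → i ≤ n →
    merge (k := k) (A := A) n i ∘ₗ ins (n + 1) i = LinearMap.id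
  | n, 0, _ => ext_cons fun a x => by
      simp [merge_zero_cons, ins_zero]
  | 0, i + 1, h => by omega
  | n + 1, i + 1, h => ext_cons fun c x => by
      have := LinearMap.congr_fun (merge_ins_self n i (by omega)) x
      simp only [LinearMap.comp_apply, ins_succ_cons, merge_succ_cons, LinearMap.id_apply] at this ⊢
      rw [this]

theorem merge_ins_gt : (n i j : ℕ) → j ≤ i → i ≤ n →
    merge (k := k) (A := A) (n + 1) (i + 1) ∘ₗ ins (n + 2) j = ins (n + 1) j ∘ₗ merge n i
  | n, i, 0, _, _ => by
      ext x; simp [ins_zero, merge_succ_cons]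
  | 0, i, j + 1, h, h' => by omega
  | n + 1, i + 1, j + 1, h, h' => ext_cons fun c x => by
      have := LinearMap.congr_fun (merge_ins_gt n i j (by omega) (by omega)) x
      simp only [LinearMap.comp_apply, ins_succ_cons, merge_succ_cons] at this ⊢
      rw [this]

theorem rotL_merge : (n i : ℕ) → i < n →
    rotL n ∘ₗ merge (k := k) (A := A) n (i + 1) = merge n i ∘ₗ rotL (n + 1)
  | n + 1, 0, _ => ext_cons₃ fun a b c x => by
      simp [merge_zero_cons, merge_succ_cons]
  | n + 2, i + 1, h => ext_cons₂ fun a b x => by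
      have := LinearMap.congr_fun (rotL_merge (n + 1) i (by omega)) (cons a x)
      simp only [LinearMap.comp_apply, merge_succ_cons, rotL_cons] at this ⊢
      rw [this]

theorem rotL_ins : (n i : ℕ) → i ≤ n →
    rotL (n + 1) ∘ₗ ins (k := k) (A := A) (n + 1) (i + 1) = ins (n + 1) i ∘ₗ rotL n
  | n, 0, _ => ext_cons fun a x => by
      simp [ins_zero, ins_succ_cons]
  | 0, i + 1, h => by omega
  | n + 1, i + 1, h => ext_cons₂ fun a b x => by
      have := LinearMap.congr_fun (rotL_ins n i (by omega)) (cons a x)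
      simp only [LinearMap.comp_apply, ins_succ_cons, rotL_cons] at this ⊢
      rw [this]

theorem rotR_merge (n i : ℕ) (h : i < n) :
    merge (k := k) (A := A) n (i + 1) ∘ₗ rotR (n + 1) = rotR n ∘ₗ merge n i := by
  ext x
  have h1 := LinearMap.congr_fun (rotL_merge (k := k) (A := A) n i h) (rotR (n + 1) x)
  have h2 := LinearMap.congr_fun (rotL_rotR (k := k) (V := A) (n + 1)) x
  simp only [LinearMap.comp_apply, LinearMap.id_apply] at h1 h2 ⊢
  rw [h2] at h1
  rw [← h1]
  exact (LinearMap.congr_fun (rotR_rotL (k := k) (V := A) n) _).symm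

theorem rotR_ins (n i : ℕ) (h : i ≤ n) :
    ins (k := k) (A := A) (n + 1) (i + 1) ∘ₗ rotR n = rotR (n + 1) ∘ₗ ins (n + 1) i := by
  ext x
  have h1 := LinearMap.congr_fun (rotL_ins (k := k) (A := A) n i h) (rotR n x)
  have h2 := LinearMap.congr_fun (rotL_rotR (k := k) (V := A) n) x
  simp only [LinearMap.comp_apply, LinearMap.id_apply] at h1 h2 ⊢
  rw [h2] at h1
  rw [← h1]
  exact (LinearMap.congr_fun (rotR_rotL (k := k) (V := A) (n + 1)) _).symm

/-- A unit in the last position is rotated to the front. -/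
theorem rotR_ins_last : (n : ℕ) → (x : TPow k A n) → rotR n (ins n n x) = cons 1 x
  | 0, x => by simp [ins_zero, rotR]
  | n + 1, x => by
      have : rotR (n + 1) ∘ₗ ins (k := k) (A := A) (n + 1) (n + 1) = cons 1 := ext_cons fun a x => by
        simp [ins_succ_cons, rotR_succ_cons, rotR_ins_last n]
      exact LinearMap.congr_fun this x

end Alg
end TensorPower

/-! ### Hopf algebra actions and coefficients -/

section HopfActions

open Coalgebra TPow

variable (k : Type u) [Field k]

/-- A left `H`-module algebra: `h(ab) = (h₍₁₎a)(h₍₂₎b)` and `h1 = ε(h)1`. -/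
class HopfModuleAlgebra (H A : Type u) [Ring H] [HopfAlgebra k H] [Ring A] [Algebra k A]
    [Module H A] [IsScalarTower k H A] : Prop where
  smul_mul : ∀ (h : H) (a b : A), h • (a * b) = sweedler k h fun h₁ h₂ => (h₁ • a) * (h₂ • b)
  smul_one : ∀ h : H, h • (1 : A) = counit (R := k) h • (1 : A)

/-- A left `H`-module coalgebra: `Δ(hc) = h₍₁₎c₍₁₎ ⊗ h₍₂₎c₍₂₎` and `ε(hc) = ε(h)ε(c)`. -/
class HopfModuleCoalgebra (H C : Type u) [Ring H] [HopfAlgebra k H] [AddCommGroup C] [Module k C]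
    [Coalgebra k C] [Module H C] [IsScalarTower k H C] : Prop where
  comul_smul : ∀ (h : H) (c : C), comul (R := k) (h • c) =
    sweedler k h fun h₁ h₂ => sweedler k c fun c₁ c₂ => (h₁ • c₁) ⊗ₜ[k] (h₂ • c₂)
  counit_smul : ∀ (h : H) (c : C), counit (R := k) (h • c) = counit (R := k) h * counit (R := k) c

/-- The action `H → End(V)` of a left `H`-module, as a linear map. -/
noncomputable def act {H V : Type u} [Ring H] [Algebra k H] [AddCommGroup V] [Module k V]
    [Module H V] [IsScalarTower k H V] : H →ₗ[k] V →ₗ[k] V :=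
  (Algebra.lsmul k k V : H →ₐ[k] Module.End k V).toLinearMap

/-- The right action `h ↦ (m ↦ mh)` of a right `H`-module, as a linear map. -/
noncomputable def ract {H M : Type u} [Ring H] [Algebra k H] [AddCommGroup M] [Module k M]
    [Module Hᵐᵒᵖ M] [IsScalarTower k Hᵐᵒᵖ M] : H →ₗ[k] M →ₗ[k] M :=
  (Algebra.lsmul k k M : Hᵐᵒᵖ →ₐ[k] Module.End k M).toLinearMap ∘ₗ
    (MulOpposite.opLinearEquiv k).toLinearMap

/-- A right-left stable anti-Yetter-Drinfeld module: a right `H`-module `M` with a left coaction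
`∇(m) = m₍₋₁₎ ⊗ m₍₀₎` such that `∇(mh) = S(h₍₃₎) m₍₋₁₎ h₍₁₎ ⊗ m₍₀₎ h₍₂₎` and `m₍₀₎ m₍₋₁₎ = m`. -/
class SAYDModule (H M : Type u) [Ring H] [HopfAlgebra k H] [AddCommGroup M] [Module k M]
    [Module Hᵐᵒᵖ M] [IsScalarTower k Hᵐᵒᵖ M] where
  coact : M →ₗ[k] H ⊗[k] M
  coassoc : (TensorProduct.assoc k H H M).toLinearMap ∘ₗ
    LinearMap.rTensor M (comul (R := k) (A := H)) ∘ₗ coact = LinearMap.lTensor H coact ∘ₗ coact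
  counit_coact : LinearMap.rTensor M (counit (R := k) (A := H)) ∘ₗ coact = TensorProduct.mk k k M 1
  ayd : ∀ (m : M) (h : H), coact (MulOpposite.op h • m) =
    sweedler k h fun h₁ h' => sweedler k h' fun h₂ h₃ =>
      TensorProduct.map
        (LinearMap.mulLeft k (HopfAlgebra.antipode k h₃) ∘ₗ LinearMap.mulRight k h₁)
        (ract k h₂) (coact m)
  stable : ∀ m : M, TensorProduct.lift (ract k) (coact m) = m

/-- An action of the coalgebra `C` on the algebra `A` that is equivariant for the actions of `H`:
`c(ab) = (c₍₁₎a)(c₍₂₎b)`, `c1 = ε(c)1` and `h(ca) = (hc)a`. -/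
structure EquivariantAction (H C A : Type u) [Ring H] [HopfAlgebra k H] [AddCommGroup C]
    [Module k C] [Coalgebra k C] [Module H C] [Ring A] [Algebra k A] [Module H A] where
  act : C →ₗ[k] A →ₗ[k] A
  act_mul : ∀ (c : C) (a b : A), act c (a * b) = sweedler k c fun c₁ c₂ => act c₁ a * act c₂ b
  act_one : ∀ c : C, act c 1 = counit (R := k) c • (1 : A)
  smul_act : ∀ (h : H) (c : C) (a : A), h • act c a = act (h • c) a

variable {k} {H V M : Type u} [Ring H] [HopfAlgebra k H]
  [AddCommGroup V] [Module k V] [Module H V] [IsScalarTower k H V]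
  [AddCommGroup M] [Module k M] [Module Hᵐᵒᵖ M] [IsScalarTower k Hᵐᵒᵖ M]

theorem act_apply (h : H) (v : V) : act k h v = h • v := rfl

theorem act_mul_apply (g h : H) (v : V) : act k (g * h) v = act k g (act k h v) := mul_smul g h v

theorem ract_apply (h : H) (m : M) : ract k h m = MulOpposite.op h • m := rfl

/-- The diagonal action `h(v₀ ⊗ ⋯ ⊗ v_{n-1}) = h₍₁₎v₀ ⊗ ⋯ ⊗ h₍ₙ₎v_{n-1}` on `V^{⊗ n}`. -/
noncomputable def rho (k : Type u) [Field k] (H V : Type u) [Ring H] [HopfAlgebra k H]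
    [AddCommGroup V] [Module k V] [Module H V] [IsScalarTower k H V] :
    (n : ℕ) → H →ₗ[k] TPow k V n →ₗ[k] TPow k V n
  | 0 => (counit (R := k) (A := H)).smulRight LinearMap.id
  | n + 1 => TensorProduct.homTensorHomMap (.id k) V (TPow k V n) V (TPow k V n) ∘ₗ
      TensorProduct.map (act k) (rho k H V n) ∘ₗ comul (R := k) (A := H)

theorem rho_zero (h : H) (x : TPow k V 0) : rho k H V 0 h x = counit (R := k) h • x := rfl

theorem rho_cons {n : ℕ} (h : H) (v : V) (x : TPow k V n) :
    rho k H V (n + 1) h (cons v x) = sweedler k h fun a b => cons (act k a v) (rho k H V n b x) := by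
  let F : H ⊗[k] H →ₗ[k] TPow k V (n + 1) :=
    LinearMap.applyₗ (cons v x : TPow k V (n + 1)) ∘ₗ
      TensorProduct.homTensorHomMap (.id k) V (TPow k V n) V (TPow k V n) ∘ₗ
      TensorProduct.map (act k) (rho k H V n)
  have hF : ∀ a b, F (a ⊗ₜ b) = cons (act k a v) (rho k H V n b x) := fun a b => rfl
  rw [sweedler_of_comul F hF]
  rfl

/-- The same action on the first `j` tensor factors only. -/
noncomputable def part (k : Type u) [Field k] (H V : Type u) [Ring H] [HopfAlgebra k H]
    [AddCommGroup V] [Module k V] [Module H V] [IsScalarTower k H V] :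
    (n j : ℕ) → H →ₗ[k] TPow k V n →ₗ[k] TPow k V n
  | 0, _ => (counit (R := k) (A := H)).smulRight LinearMap.id
  | _ + 1, 0 => (counit (R := k) (A := H)).smulRight LinearMap.id
  | n + 1, j + 1 => TensorProduct.homTensorHomMap (.id k) V (TPow k V n) V (TPow k V n) ∘ₗ
      TensorProduct.map (act k) (part k H V n j) ∘ₗ comul (R := k) (A := H)

theorem part_zero {n : ℕ} (h : H) (x : TPow k V n) : part k H V n 0 h x = counit (R := k) h • x := by
  cases n <;> rfl

theorem part_cons {n j : ℕ} (h : H) (v : V) (x : TPow k V n) :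
    part k H V (n + 1) (j + 1) h (cons v x) =
      sweedler k h fun a b => cons (act k a v) (part k H V n j b x) := by
  let F : H ⊗[k] H →ₗ[k] TPow k V (n + 1) :=
    LinearMap.applyₗ (cons v x : TPow k V (n + 1)) ∘ₗ
      TensorProduct.homTensorHomMap (.id k) V (TPow k V n) V (TPow k V n) ∘ₗ
      TensorProduct.map (act k) (part k H V n j)
  have hF : ∀ a b, F (a ⊗ₜ b) = cons (act k a v) (part k H V n j b x) := fun a b => rfl
  rw [sweedler_of_comul F hF]
  rfl

theorem part_self : (n : ℕ) → part k H V n n = rho k H V n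
  | 0 => rfl
  | n + 1 => by rw [part, rho, part_self n]

theorem part_succ : (n j : ℕ) → j < n → (h : H) → (x : TPow k V n) →
    part k H V n (j + 1) h x = sweedler k h fun a b => slot n j (act k b) (part k H V n j a x)
  | n + 1, 0, _, h, x => by
      revert x
      suffices e : part k H V (n + 1) 1 h = sweedler k h fun a b =>
          slot (n + 1) 0 (act k b) ∘ₗ part k H V (n + 1) 0 a by
        intro x; rw [e, sweedler_apply]; rfl
      refine ext_cons fun v x => ?_
      simp only [part_cons, sweedler_apply, LinearMap.comp_apply, part_zero, map_smul,
        slot_zero_cons]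
      have e1 := sweedler_counit_right (cons.flip x ∘ₗ (act k).flip v) h
      have e2 := sweedler_counit_left (cons.flip x ∘ₗ (act k).flip v) h
      simp only [LinearMap.comp_apply, LinearMap.flip_apply] at e1 e2
      rw [e1, e2]
  | n + 1, j + 1, hj, h, x => by
      revert x
      suffices e : part k H V (n + 1) (j + 1 + 1) h = sweedler k h fun a b =>
          slot (n + 1) (j + 1) (act k b) ∘ₗ part k H V (n + 1) (j + 1) a by
        intro x; rw [e, sweedler_apply]; rfl
      refine ext_cons fun v x => ?_
      simp only [part_cons, sweedler_apply, LinearMap.comp_apply, sweedler_map, slot_succ_cons,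
        part_succ n j (by omega)]
      exact sweedler_coassoc
        (f := fun a b c => cons (act k a v) (slot n j (act k c) (part k H V n j b x)))
        ⟨by simp, by simp, by simp, by simp, by simp, by simp⟩ h

theorem rho_rotL : (n : ℕ) → (h : H) → (v : V) → (y : TPow k V n) →
    rho k H V (n + 1) h (rotL n (cons v y)) =
      sweedler k h fun a b => rotL n (cons (act k b v) (rho k H V n a y))
  | 0, h, v, y => by
      simp only [rotL_zero, rho_cons, rho_zero, map_smul]
      have e1 := sweedler_counit_right (cons.flip y ∘ₗ (act k).flip v) h
      have e2 := sweedler_counit_left (cons.flip y ∘ₗ (act k).flip v) h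
      simp only [LinearMap.comp_apply, LinearMap.flip_apply] at e1 e2
      rw [e1, e2]
  | n + 1, h, v, y => by
      revert y
      suffices e : rho k H V (n + 2) h ∘ₗ rotL (n + 1) ∘ₗ cons v = sweedler k h fun a b =>
          rotL (n + 1) ∘ₗ cons (act k b v) ∘ₗ rho k H V (n + 1) a by
        intro y
        have := LinearMap.congr_fun e y
        rw [sweedler_apply] at this
        exact this
      refine ext_cons fun w x => ?_
      simp only [sweedler_apply, LinearMap.comp_apply, rotL_cons, rho_cons, rho_rotL n,
        sweedler_map]
      exact sweedler_coassoc
        (f := fun a b c => cons (act k a w) (rotL n (cons (act k c v) (rho k H V n b x))))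
        ⟨by simp, by simp, by simp, by simp, by simp, by simp⟩ h

theorem slot_rotL_pow (n j : ℕ) (hj : j ≤ n) (f : V →ₗ[k] V) (x : TPow k V (n + 1)) :
    head f ((rotL n ^ j) x) = (rotL n ^ j) (slot (n + 1) j f x) := by
  induction j generalizing x with
  | zero => rfl
  | succ j ih =>
    rw [pow_succ, Module.End.mul_apply, Module.End.mul_apply, ih (by omega)]
    congr 1
    exact LinearMap.congr_fun (slot_rotL n j (by omega) f) x

/-! The structure maps on tensor powers are `H`-linear. -/

section Equivariance

variable {C A : Type u} [AddCommGroup C] [Module k C] [Coalgebra k C] [Module H C]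
  [IsScalarTower k H C] [HopfModuleCoalgebra k H C] [Ring A] [Algebra k A] [Module H A]
  [IsScalarTower k H A] [HopfModuleAlgebra k H A]

theorem act_mul_eq (h : H) (a b : A) :
    act k h (a * b) = sweedler k h fun p q => act k p a * act k q b :=
  HopfModuleAlgebra.smul_mul h a b

theorem rho_split (h : H) : (n i : ℕ) →
    rho k H C (n + 1) h ∘ₗ split n i = split n i ∘ₗ rho k H C n h
  | 0, i => by simp [split]
  | n + 1, 0 => ext_cons fun c x => by
      have e : ∀ a b : H, split (k := k) (n + 1) 0 (cons (act k a c) (rho k H C n b x)) =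
          sweedler k a fun a₁ a₂ => sweedler k c fun c₁ c₂ =>
            cons (act k a₁ c₁) (cons (act k a₂ c₂) (rho k H C n b x)) := by
        intro a b
        let F : C ⊗[k] C →ₗ[k] TPow k C (n + 2) :=
          TensorProduct.lift ((LinearMap.llcomp k _ _ _).flip (cons.flip (rho k H C n b x)) ∘ₗ cons)
        have hF : ∀ c d, F (c ⊗ₜ d) = cons c (cons d (rho k H C n b x)) := fun c d => rfl
        rw [split_zero_cons, sweedler_of_comul F hF, act_apply, HopfModuleCoalgebra.comul_smul]
        simp only [sweedler_map, hF, act_apply]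
      simp only [LinearMap.comp_apply, split_zero_cons, sweedler_map, rho_cons, e]
      rw [← sweedler_coassoc (f := fun a₁ a₂ b => sweedler k c fun c₁ c₂ =>
            cons (act k a₁ c₁) (cons (act k a₂ c₂) (rho k H C n b x)))
        ⟨by simp [sweedler_add_right], by simp [sweedler_smul_right], by simp [sweedler_add_right],
          by simp [sweedler_smul_right], by simp [sweedler_add_right],
          by simp [sweedler_smul_right]⟩ h]
      simp only [sweedler]
      rw [Finset.sum_comm]
      refine Finset.sum_congr rfl fun i _ => ?_
      rw [Finset.sum_comm]
  | n + 1, i + 1 => ext_cons fun c x => by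
      have := fun b => LinearMap.congr_fun (rho_split b n i) x
      simp only [LinearMap.comp_apply] at this
      simp only [LinearMap.comp_apply, split_succ_cons, rho_cons, sweedler_map, this]

theorem rho_del (h : H) : (n i : ℕ) →
    rho k H C n h ∘ₗ del n i = del n i ∘ₗ rho k H C (n + 1) h
  | n, 0 => ext_cons fun c x => by
      simp only [LinearMap.comp_apply, del_zero_cons, rho_cons, sweedler_map, act_apply,
        HopfModuleCoalgebra.counit_smul, map_smul, mul_comm _ (counit (R := k) c), mul_smul]
      have e := sweedler_counit_left ((rho k H C n).flip x) h
      simp only [LinearMap.flip_apply] at e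
      rw [sweedler_smul_right, e]
  | 0, i + 1 => by simp [del]
  | n + 1, i + 1 => ext_cons fun c x => by
      have := fun b => LinearMap.congr_fun (rho_del b n i) x
      simp only [LinearMap.comp_apply] at this
      simp only [LinearMap.comp_apply, del_succ_cons, rho_cons, sweedler_map, this]

theorem rho_merge (h : H) : (n i : ℕ) →
    rho k H A (n + 1) h ∘ₗ merge n i = merge n i ∘ₗ rho k H A (n + 2) h
  | n, 0 => ext_cons₂ fun a b x => by
      simp only [LinearMap.comp_apply, merge_zero_cons, rho_cons, sweedler_map, act_mul_eq,
        sweedler_apply]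
      exact (sweedler_coassoc
        (f := fun p q r => cons (act k p a * act k q b) (rho k H A n r x))
        ⟨by simp [add_mul], by simp, by simp [mul_add], by simp, by simp, by simp⟩ h).symm
  | 0, i + 1 => by simp [merge]
  | n + 1, i + 1 => ext_cons fun c x => by
      have := fun b => LinearMap.congr_fun (rho_merge b n i) x
      simp only [LinearMap.comp_apply] at this
      simp only [LinearMap.comp_apply, merge_succ_cons, rho_cons, sweedler_map, this]

theorem rho_ins (h : H) : (n i : ℕ) →
    rho k H A (n + 1) h ∘ₗ ins n i = ins n i ∘ₗ rho k H A n h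
  | n, 0 => LinearMap.ext fun x => by
      simp only [LinearMap.comp_apply, ins_zero, rho_cons, act_apply,
        HopfModuleAlgebra.smul_one (k := k), map_smul, LinearMap.smul_apply]
      exact sweedler_counit_left (cons 1 ∘ₗ (rho k H A n).flip x) h
  | 0, i + 1 => by simp [ins]
  | n + 1, i + 1 => ext_cons fun c x => by
      have := fun b => LinearMap.congr_fun (rho_ins b n i) x
      simp only [LinearMap.comp_apply] at this
      simp only [LinearMap.comp_apply, ins_succ_cons, rho_cons, sweedler_map, this]

end Equivariance

/-! ### Twisted operators on `M ⊗ V^{⊗ n}` and the balanced tensor product `M ⊗_H V^{⊗ n}` -/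

section Twist

variable [SAYDModule k H M] {T T' T'' : Type u} [AddCommGroup T] [Module k T] [AddCommGroup T']
  [Module k T'] [AddCommGroup T''] [Module k T'']

/-- For `w = ∑ h ⊗ m` the element `∑ m ⊗ Φ(h)(x)`. -/
noncomputable def twistAux (M : Type u) [AddCommGroup M] [Module k M] (Φ : H →ₗ[k] T →ₗ[k] T')
    (x : T) : H ⊗[k] M →ₗ[k] M ⊗[k] T' :=
  (TensorProduct.comm k T' M).toLinearMap ∘ₗ LinearMap.rTensor M (Φ.flip x)

@[simp] theorem twistAux_tmul (Φ : H →ₗ[k] T →ₗ[k] T') (x : T) (h : H) (m : M) :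
    twistAux M Φ x (h ⊗ₜ m) = m ⊗ₜ Φ h x := rfl

/-- The operator `m ⊗ x ↦ m₍₀₎ ⊗ Φ(m₍₋₁₎)(x)`. -/
noncomputable def twist (M : Type u) [AddCommGroup M] [Module k M] [Module Hᵐᵒᵖ M]
    [IsScalarTower k Hᵐᵒᵖ M] [SAYDModule k H M] (Φ : H →ₗ[k] T →ₗ[k] T') :
    M ⊗[k] T →ₗ[k] M ⊗[k] T' :=
  LinearMap.lTensor M (TensorProduct.lift Φ) ∘ₗ
    (TensorProduct.leftComm k H M T).toLinearMap ∘ₗ (TensorProduct.assoc k H M T).toLinearMap ∘ₗ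
    LinearMap.rTensor T (SAYDModule.coact (k := k) (H := H) (M := M))

theorem twist_tmul (Φ : H →ₗ[k] T →ₗ[k] T') (m : M) (x : T) :
    twist M Φ (m ⊗ₜ x) = twistAux M Φ x (SAYDModule.coact m) := by
  have : ∀ w : H ⊗[k] M, LinearMap.lTensor M (TensorProduct.lift Φ)
      (TensorProduct.leftComm k H M T (TensorProduct.assoc k H M T (w ⊗ₜ x))) =
      twistAux M Φ x w := by
    intro w
    induction w with
    | zero => simp
    | tmul h m => simp
    | add a b ha hb => simp [TensorProduct.add_tmul, ha, hb]
  exact this _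

theorem lTensor_comp_twist (f : T' →ₗ[k] T'') (Φ : H →ₗ[k] T →ₗ[k] T') (Ψ : H →ₗ[k] T →ₗ[k] T'')
    (h : ∀ a x, f (Φ a x) = Ψ a x) : LinearMap.lTensor M f ∘ₗ twist M Φ = twist M Ψ := by
  refine TensorProduct.ext' fun m x => ?_
  rw [LinearMap.comp_apply, twist_tmul, twist_tmul]
  induction (SAYDModule.coact m : H ⊗[k] M) with
  | zero => simp
  | tmul a m => simp [h]
  | add a b ha hb => simp [ha, hb]

theorem twist_comp_lTensor (f : T →ₗ[k] T') (Φ : H →ₗ[k] T' →ₗ[k] T'') (Ψ : H →ₗ[k] T →ₗ[k] T'')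
    (h : ∀ a x, Φ a (f x) = Ψ a x) : twist M Φ ∘ₗ LinearMap.lTensor M f = twist M Ψ := by
  refine TensorProduct.ext' fun m x => ?_
  rw [LinearMap.comp_apply, LinearMap.lTensor_tmul, twist_tmul, twist_tmul]
  induction (SAYDModule.coact m : H ⊗[k] M) with
  | zero => simp
  | tmul a m => simp [h]
  | add a b ha hb => simp [ha, hb]

theorem twist_comp_twist (Ψ : H →ₗ[k] T' →ₗ[k] T'') (Φ : H →ₗ[k] T →ₗ[k] T')
    (K : H →ₗ[k] T →ₗ[k] T'') (hK : ∀ h x, K h x = sweedler k h fun a b => Ψ b (Φ a x)) :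
    twist M Ψ ∘ₗ twist M Φ = twist M K := by
  refine TensorProduct.ext' fun m x => ?_
  rw [LinearMap.comp_apply, twist_tmul, twist_tmul]
  let P : H →ₗ[k] H →ₗ[k] T'' := Ψ.flip ∘ₗ Φ.flip x
  let Q : (H ⊗[k] H) ⊗[k] M →ₗ[k] M ⊗[k] T'' :=
    (TensorProduct.comm k T'' M).toLinearMap ∘ₗ LinearMap.rTensor M (TensorProduct.lift P)
  have h1 : ∀ w : H ⊗[k] M, twist M Ψ (twistAux M Φ x w) =
      Q ((TensorProduct.assoc k H H M).symm (LinearMap.lTensor H SAYDModule.coact w)) := by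
    intro w
    induction w with
    | zero => simp
    | tmul a m =>
      rw [twistAux_tmul, twist_tmul, LinearMap.lTensor_tmul]
      induction (SAYDModule.coact m : H ⊗[k] M) with
      | zero => simp
      | tmul b m => simp [Q, P]
      | add a b ha hb => simp [ha, hb, TensorProduct.tmul_add]
    | add a b ha hb => simp [ha, hb]
  have h2 : ∀ w : H ⊗[k] M, Q (LinearMap.rTensor M comul w) = twistAux M K x w := by
    intro w
    induction w with
    | zero => simp
    | tmul a m =>
      have : TensorProduct.lift P (comul a) = K a x := by
        rw [hK, ← sweedler_eq_lift]; rfl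
      simp [Q, this]
    | add a b ha hb => simp [ha, hb]
  have h3 := LinearMap.congr_fun (SAYDModule.coassoc (k := k) (H := H) (M := M)) m
  simp only [LinearMap.comp_apply, LinearEquiv.coe_coe] at h3
  rw [h1, ← h3, LinearEquiv.symm_apply_apply, h2]

theorem twist_counit (f : T →ₗ[k] T') (K : H →ₗ[k] T →ₗ[k] T')
    (hK : ∀ h x, K h x = counit (R := k) h • f x) : twist M K = LinearMap.lTensor M f := by
  refine TensorProduct.ext' fun m x => ?_
  rw [twist_tmul, LinearMap.lTensor_tmul]
  have h1 : ∀ w : H ⊗[k] M, twistAux M K x w =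
      TensorProduct.lid k M (LinearMap.rTensor M counit w) ⊗ₜ f x := by
    intro w
    induction w with
    | zero => simp
    | tmul a m => simp [hK, TensorProduct.smul_tmul']
    | add a b ha hb => simp [ha, hb, TensorProduct.add_tmul]
  have h3 := LinearMap.congr_fun (SAYDModule.counit_coact (k := k) (H := H) (M := M)) m
  simp only [LinearMap.comp_apply] at h3
  rw [h1, h3]; simp

end Twist

variable (k H V M) in
/-- The relations `mh ⊗ x = m ⊗ hx`. -/
noncomputable def balRel (n : ℕ) : Submodule k (M ⊗[k] TPow k V n) :=
  Submodule.span k {z | ∃ (m : M) (h : H) (x : TPow k V n),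
    z = (MulOpposite.op h • m) ⊗ₜ[k] x - m ⊗ₜ[k] rho k H V n h x}

variable (k H V M) in
/-- The balanced tensor product `M ⊗_H V^{⊗ n}`. -/
abbrev Bal (n : ℕ) : Type u := (M ⊗[k] TPow k V n) ⧸ balRel k H V M n

/-- The class of `m ⊗ x` in `M ⊗_H V^{⊗ n}`. -/
noncomputable def bal {n : ℕ} (m : M) (x : TPow k V n) : Bal k H V M n :=
  (balRel k H V M n).mkQ (m ⊗ₜ[k] x)

theorem bal_smul {n : ℕ} (m : M) (h : H) (x : TPow k V n) :
    (balRel k H V M n).mkQ ((MulOpposite.op h • m) ⊗ₜ[k] x) =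
      (balRel k H V M n).mkQ (m ⊗ₜ[k] rho k H V n h x) := by
  rw [← sub_eq_zero, ← map_sub, Submodule.mkQ_apply, Submodule.Quotient.mk_eq_zero]
  exact Submodule.subset_span ⟨m, h, x, rfl⟩

theorem balRel_le {n : ℕ} {W : Type u} [AddCommGroup W] [Module k W]
    (f : M ⊗[k] TPow k V n →ₗ[k] W)
    (hf : ∀ m h x, f ((MulOpposite.op h • m) ⊗ₜ[k] x) = f (m ⊗ₜ[k] rho k H V n h x)) :
    balRel k H V M n ≤ LinearMap.ker f := by
  refine Submodule.span_le.2 ?_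
  rintro _ ⟨m, h, x, rfl⟩
  simp [hf]

/-- The map `M ⊗_H V^{⊗ n} → M ⊗_H V^{⊗ m}` induced by an `H`-linear map. -/
noncomputable def balMap {n m : ℕ} (f : TPow k V n →ₗ[k] TPow k V m)
    (hf : ∀ h, rho k H V m h ∘ₗ f = f ∘ₗ rho k H V n h) :
    Bal k H V M n →ₗ[k] Bal k H V M m :=
  (balRel k H V M n).mapQ (balRel k H V M m) (LinearMap.lTensor M f) <| by
    rw [← Submodule.ker_mkQ (balRel k H V M m), ← LinearMap.ker_comp]
    refine balRel_le _ fun a h x => ?_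
    have := LinearMap.congr_fun (hf h) x
    simp only [LinearMap.comp_apply] at this
    simp only [LinearMap.comp_apply, LinearMap.lTensor_tmul, ← this, bal_smul]

variable [SAYDModule k H M]

variable (k H V M) in
/-- The cyclic operator `m ⊗ v₀ ⊗ ⋯ ⊗ v_n ↦ m₍₀₎ ⊗ v₁ ⊗ ⋯ ⊗ v_n ⊗ m₍₋₁₎v₀`. -/
noncomputable def cycL (n : ℕ) : M ⊗[k] TPow k V (n + 1) →ₗ[k] M ⊗[k] TPow k V (n + 1) :=
  LinearMap.lTensor M (rotL n) ∘ₗ twist M (head ∘ₗ act k (H := H) (V := V))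

/-- The antipode of `H`, assumed bijective, as a linear equivalence. -/
noncomputable def antipodeEquiv (hS : Function.Bijective (HopfAlgebra.antipode k : H →ₗ[k] H)) :
    H ≃ₗ[k] H := LinearEquiv.ofBijective _ hS

variable (V M) in
/-- The cyclic operator `m ⊗ v₀ ⊗ ⋯ ⊗ v_n ↦ m₍₀₎ ⊗ S⁻¹(m₍₋₁₎)v_n ⊗ v₀ ⊗ ⋯ ⊗ v_{n-1}`. -/
noncomputable def cycR (hS : Function.Bijective (HopfAlgebra.antipode k : H →ₗ[k] H)) (n : ℕ) :
    M ⊗[k] TPow k V (n + 1) →ₗ[k] M ⊗[k] TPow k V (n + 1) :=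
  twist M (head ∘ₗ act k (H := H) (V := V) ∘ₗ (antipodeEquiv hS).symm.toLinearMap) ∘ₗ
    LinearMap.lTensor M (rotR n)

theorem cycL_pow (n j : ℕ) (hj : j ≤ n + 1) : (cycL k H V M n ^ j : Module.End k _) =
    LinearMap.lTensor M (rotL n ^ j) ∘ₗ twist M (part k H V (n + 1) j) := by
  induction j with
  | zero =>
    rw [twist_counit LinearMap.id _ fun h x => part_zero h x, pow_zero, pow_zero]
    refine TensorProduct.ext' fun m x => ?_
    simp
  | succ j ih =>
    have h1 : twist M (head ∘ₗ act k (H := H) (V := V)) ∘ₗ LinearMap.lTensor M (rotL n ^ j) =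
        LinearMap.lTensor M (rotL n ^ j) ∘ₗ
          twist M (slot (n + 1) j ∘ₗ act k (H := H) (V := V)) := by
      rw [lTensor_comp_twist (rotL n ^ j) _
        ((LinearMap.compRight k (rotL n ^ j)) ∘ₗ slot (n + 1) j ∘ₗ act k (H := H) (V := V))
        (fun a x => rfl)]
      exact twist_comp_lTensor _ _ _ fun a x => slot_rotL_pow n j (by omega) (act k a) x
    have h2 := twist_comp_twist (M := M) (slot (n + 1) j ∘ₗ act k (H := H) (V := V))
      (part k H V (n + 1) j) (part k H V (n + 1) (j + 1)) (part_succ (n + 1) j (by omega))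
    rw [pow_succ', ih (by omega), ← h2]
    refine LinearMap.ext fun x => ?_
    have h3 := LinearMap.congr_fun h1 (twist M (part k H V (n + 1) j) x)
    simp only [LinearMap.comp_apply] at h3
    simp only [Module.End.mul_apply, LinearMap.comp_apply, cycL, h3]
    rw [← LinearMap.comp_apply, ← LinearMap.lTensor_comp, pow_succ']
    rfl

theorem mkQ_twist_rho (n : ℕ) (z : M ⊗[k] TPow k V n) :
    (balRel k H V M n).mkQ (twist M (rho k H V n) z) = (balRel k H V M n).mkQ z := by
  have : (balRel k H V M n).mkQ ∘ₗ twist M (rho k H V n) = (balRel k H V M n).mkQ := by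
    refine TensorProduct.ext' fun m x => ?_
    rw [LinearMap.comp_apply, twist_tmul]
    have h1 : ∀ w : H ⊗[k] M, (balRel k H V M n).mkQ (twistAux M (rho k H V n) x w) =
        (balRel k H V M n).mkQ (TensorProduct.lift (ract k) w ⊗ₜ x) := by
      intro w
      induction w with
      | zero => simp
      | tmul a m => rw [twistAux_tmul, TensorProduct.lift.tmul, ract_apply, bal_smul]
      | add a b ha hb => simp only [map_add, TensorProduct.add_tmul, ha, hb]
    rw [h1, SAYDModule.stable]
  exact LinearMap.congr_fun this z

theorem mkQ_cycL_pow (n : ℕ) (z : M ⊗[k] TPow k V (n + 1)) :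
    (balRel k H V M (n + 1)).mkQ ((cycL k H V M n ^ (n + 1) : Module.End k _) z) =
      (balRel k H V M (n + 1)).mkQ z := by
  rw [cycL_pow n (n + 1) le_rfl, rotL_pow_self, part_self, LinearMap.comp_apply]
  have : LinearMap.lTensor M (1 : Module.End k (TPow k V (n + 1))) = LinearMap.id :=
    LinearMap.lTensor_id _ _
  rw [this, LinearMap.id_apply, mkQ_twist_rho]

/-- The cyclic operator respects the relations, by the anti-Yetter-Drinfeld condition. -/
theorem mkQ_cycL_smul (n : ℕ) (m : M) (h : H) (z : TPow k V (n + 1)) :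
    (balRel k H V M (n + 1)).mkQ (cycL k H V M n ((MulOpposite.op h • m) ⊗ₜ[k] z)) =
      (balRel k H V M (n + 1)).mkQ (cycL k H V M n (m ⊗ₜ[k] rho k H V (n + 1) h z)) := by
  revert z
  suffices e : ((balRel k H V M (n + 1)).mkQ ∘ₗ cycL k H V M n) ∘ₗ
      TensorProduct.mk k M _ (MulOpposite.op h • m) =
      ((balRel k H V M (n + 1)).mkQ ∘ₗ cycL k H V M n) ∘ₗ TensorProduct.mk k M _ m ∘ₗ
        rho k H V (n + 1) h from fun z => LinearMap.congr_fun e z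
  refine ext_cons fun v y => ?_
  simp only [LinearMap.comp_apply, TensorProduct.mk_apply, rho_cons, cycL]
  have e1 : m ⊗ₜ[k] (sweedler k h fun a b => cons (act k a v) (rho k H V n b y)) =
      sweedler k h fun a b => m ⊗ₜ[k] cons (act k a v) (rho k H V n b y) :=
    sweedler_map (TensorProduct.mk k M _ m) h _
  rw [e1]
  simp only [sweedler_map, twist_tmul, SAYDModule.ayd]
  induction (SAYDModule.coact m : H ⊗[k] M) with
  | zero => simp [sweedler]
  | add a b ha hb => simp only [map_add, sweedler_add_right, ha, hb]
  | tmul x m =>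
    simp only [TensorProduct.map_tmul, twistAux_tmul, LinearMap.lTensor_tmul, LinearMap.comp_apply,
      ract_apply, bal_smul, LinearMap.mulLeft_apply, LinearMap.mulRight_apply, head_cons, rho_rotL]
    have e2 : ∀ (c : H) (f : H → H → TPow k V (n + 1)),
        (balRel k H V M (n + 1)).mkQ (m ⊗ₜ[k] sweedler k c f) =
        sweedler k c fun a b => (balRel k H V M (n + 1)).mkQ (m ⊗ₜ[k] f a b) := fun c f =>
      sweedler_map ((balRel k H V M (n + 1)).mkQ ∘ₗ TensorProduct.mk k M _ m) c f
    simp only [e2]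
    unfold sweedler
    refine Finset.sum_congr rfl fun i _ => ?_
    generalize (ℛ k h).left i = a
    generalize (ℛ k h).right i = b
    change sweedler k b (fun c d => sweedler k c fun c₁ c₂ => (balRel k H V M (n + 1)).mkQ
      (m ⊗ₜ[k] rotL n (cons (act k c₂ (act k (HopfAlgebra.antipode k d * (x * a)) v))
        (rho k H V n c₁ y)))) = _
    rw [← sweedler_coassoc (f := fun c₁ c₂ d => (balRel k H V M (n + 1)).mkQ
      (m ⊗ₜ[k] rotL n (cons (act k c₂ (act k (HopfAlgebra.antipode k d * (x * a)) v))
        (rho k H V n c₁ y)))) ⟨by simp [TensorProduct.tmul_add], by simp,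
          by simp [TensorProduct.tmul_add], by simp,
          by simp [TensorProduct.tmul_add, add_mul], by simp⟩ b]
    have e3 : ∀ c₁ e : H, (sweedler k e fun c₂ d => (balRel k H V M (n + 1)).mkQ
        (m ⊗ₜ[k] rotL n (cons (act k c₂ (act k (HopfAlgebra.antipode k d * (x * a)) v))
          (rho k H V n c₁ y)))) = counit (R := k) e • ((balRel k H V M (n + 1)).mkQ ∘ₗ
            TensorProduct.mk k M _ m ∘ₗ rotL n ∘ₗ cons (act k x (act k a v)) ∘ₗ
              (rho k H V n).flip y) c₁ := by
      intro c₁ e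
      let G : H →ₗ[k] Bal k H V M (n + 1) := (balRel k H V M (n + 1)).mkQ ∘ₗ
        TensorProduct.mk k M _ m ∘ₗ rotL n ∘ₗ cons.flip (rho k H V n c₁ y) ∘ₗ (act k).flip v ∘ₗ
          LinearMap.mulRight k (x * a)
      have h1 : (sweedler k e fun c₂ d => (balRel k H V M (n + 1)).mkQ
        (m ⊗ₜ[k] rotL n (cons (act k c₂ (act k (HopfAlgebra.antipode k d * (x * a)) v))
          (rho k H V n c₁ y)))) = sweedler k e fun c₂ d => G (c₂ * HopfAlgebra.antipode k d) := by
        simp only [G, LinearMap.comp_apply, LinearMap.mulRight_apply, LinearMap.flip_apply,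
          mul_assoc, act_mul_apply, TensorProduct.mk_apply]
      rw [h1, ← sweedler_map]
      have h2 : (sweedler k e fun c₂ d => c₂ * HopfAlgebra.antipode k d) =
          counit (R := k) e • (1 : H) := HopfAlgebra.sum_mul_antipode_eq_smul (ℛ k e)
      rw [h2, map_smul]
      simp only [G, LinearMap.comp_apply, LinearMap.mulRight_apply, LinearMap.flip_apply,
          one_mul, act_mul_apply, TensorProduct.mk_apply]
    simp only [e3]
    exact sweedler_counit_right _ b

variable (k H V M) in
/-- The operator induced by `cycL` on `M ⊗_H V^{⊗ (n+1)}`. -/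
noncomputable def balCycL (n : ℕ) : Bal k H V M (n + 1) →ₗ[k] Bal k H V M (n + 1) :=
  (balRel k H V M (n + 1)).mapQ (balRel k H V M (n + 1)) (cycL k H V M n) <| by
    intro z hz
    have h := balRel_le ((balRel k H V M (n + 1)).mkQ ∘ₗ cycL k H V M n)
      (fun m h z => mkQ_cycL_smul n m h z) hz
    rw [LinearMap.mem_ker, LinearMap.comp_apply, Submodule.mkQ_apply,
      Submodule.Quotient.mk_eq_zero] at h
    exact h

theorem sweedler_antipodeEquiv_mul (hS : Function.Bijective (HopfAlgebra.antipode k : H →ₗ[k] H))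
    (h : H) : (sweedler k h fun a b => (antipodeEquiv hS).symm b * a) =
      counit (R := k) h • (1 : H) := by
  apply hS.1
  have h1 : ∀ b, HopfAlgebra.antipode k ((antipodeEquiv hS).symm b) = b := fun b =>
    (antipodeEquiv hS).apply_symm_apply b
  rw [sweedler_map]
  simp only [HopfAlgebra.antipode_mul_antidistrib, h1, map_smul, HopfAlgebra.antipode_one]
  exact HopfAlgebra.sum_antipode_mul_eq_smul (ℛ k h)

theorem sweedler_mul_antipodeEquiv (hS : Function.Bijective (HopfAlgebra.antipode k : H →ₗ[k] H))
    (h : H) : (sweedler k h fun a b => b * (antipodeEquiv hS).symm a) =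
      counit (R := k) h • (1 : H) := by
  apply hS.1
  have h1 : ∀ b, HopfAlgebra.antipode k ((antipodeEquiv hS).symm b) = b := fun b =>
    (antipodeEquiv hS).apply_symm_apply b
  rw [sweedler_map]
  simp only [HopfAlgebra.antipode_mul_antidistrib, h1, map_smul, HopfAlgebra.antipode_one]
  exact HopfAlgebra.sum_mul_antipode_eq_smul (ℛ k h)

theorem cycR_cycL (hS : Function.Bijective (HopfAlgebra.antipode k : H →ₗ[k] H)) (n : ℕ)
    (z : M ⊗[k] TPow k V (n + 1)) : cycR V M hS n (cycL k H V M n z) = z := by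
  have h1 : LinearMap.lTensor M (rotR n) ∘ₗ LinearMap.lTensor M (rotL n) =
      (LinearMap.id : M ⊗[k] TPow k V (n + 1) →ₗ[k] _) := by
    rw [← LinearMap.lTensor_comp, rotR_rotL, LinearMap.lTensor_id]
  let K : H →ₗ[k] TPow k V (n + 1) →ₗ[k] TPow k V (n + 1) :=
    (counit (R := k) (A := H)).smulRight LinearMap.id
  have h2 : twist M (head ∘ₗ act k (H := H) (V := V) ∘ₗ (antipodeEquiv hS).symm.toLinearMap) ∘ₗ
      twist M (head ∘ₗ act k (H := H) (V := V)) = twist M K := by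
    refine twist_comp_twist _ _ _ fun h x => ?_
    revert x
    suffices e : K h = sweedler k h fun a b => (head ∘ₗ act k (H := H) (V := V) ∘ₗ
        (antipodeEquiv hS).symm.toLinearMap) b ∘ₗ (head ∘ₗ act k (H := H) (V := V)) a by
      intro x; rw [e, sweedler_apply]; rfl
    refine ext_cons fun v x => ?_
    simp only [sweedler_apply, LinearMap.comp_apply, head_cons, LinearEquiv.coe_coe,
      ← act_mul_apply]
    have := sweedler_map (cons.flip x ∘ₗ (act k).flip v) h
      (fun a b => (antipodeEquiv hS).symm b * a)
    simp only [LinearMap.comp_apply, LinearMap.flip_apply] at this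
    rw [← this, sweedler_antipodeEquiv_mul, map_smul, LinearMap.smul_apply, map_smul,
      LinearMap.smul_apply, act_apply, one_smul]
    rfl
  have h3 := LinearMap.congr_fun h1 (twist M (head ∘ₗ act k (H := H) (V := V)) z)
  have h4 := LinearMap.congr_fun h2 z
  rw [twist_counit LinearMap.id K (fun _ _ => rfl), LinearMap.lTensor_id] at h4
  simp only [LinearMap.comp_apply, LinearMap.id_apply] at h3 h4
  simp only [cycR, cycL, LinearMap.comp_apply, h3, h4]

theorem cycL_cycR (hS : Function.Bijective (HopfAlgebra.antipode k : H →ₗ[k] H)) (n : ℕ)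
    (z : M ⊗[k] TPow k V (n + 1)) : cycL k H V M n (cycR V M hS n z) = z := by
  have h1 : LinearMap.lTensor M (rotL n) ∘ₗ LinearMap.lTensor M (rotR n) =
      (LinearMap.id : M ⊗[k] TPow k V (n + 1) →ₗ[k] _) := by
    rw [← LinearMap.lTensor_comp, rotL_rotR, LinearMap.lTensor_id]
  let K : H →ₗ[k] TPow k V (n + 1) →ₗ[k] TPow k V (n + 1) :=
    (counit (R := k) (A := H)).smulRight LinearMap.id
  have h2 : twist M (head ∘ₗ act k (H := H) (V := V)) ∘ₗ
      twist M (head ∘ₗ act k (H := H) (V := V) ∘ₗ (antipodeEquiv hS).symm.toLinearMap) =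
        twist M K := by
    refine twist_comp_twist _ _ _ fun h x => ?_
    revert x
    suffices e : K h = sweedler k h fun a b => (head ∘ₗ act k (H := H) (V := V)) b ∘ₗ
        (head ∘ₗ act k (H := H) (V := V) ∘ₗ (antipodeEquiv hS).symm.toLinearMap) a by
      intro x; rw [e, sweedler_apply]; rfl
    refine ext_cons fun v x => ?_
    simp only [sweedler_apply, LinearMap.comp_apply, head_cons, LinearEquiv.coe_coe,
      ← act_mul_apply]
    have := sweedler_map (cons.flip x ∘ₗ (act k).flip v) h
      (fun a b => b * (antipodeEquiv hS).symm a)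
    simp only [LinearMap.comp_apply, LinearMap.flip_apply] at this
    rw [← this, sweedler_mul_antipodeEquiv, map_smul, LinearMap.smul_apply, map_smul,
      LinearMap.smul_apply, act_apply, one_smul]
    rfl
  have h3 := LinearMap.congr_fun h2 (LinearMap.lTensor M (rotR n) z)
  have h4 := LinearMap.congr_fun h1 z
  rw [twist_counit LinearMap.id K (fun _ _ => rfl), LinearMap.lTensor_id] at h3
  simp only [LinearMap.comp_apply, LinearMap.id_apply] at h3 h4
  simp only [cycR, cycL, LinearMap.comp_apply, h3, h4]

theorem cycR_mem (hS : Function.Bijective (HopfAlgebra.antipode k : H →ₗ[k] H)) (n : ℕ) :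
    balRel k H V M (n + 1) ≤ (balRel k H V M (n + 1)).comap (cycR V M hS n) := by
  intro z hz
  have h1 : (balRel k H V M (n + 1)).mkQ ((cycL k H V M n ^ n : Module.End k _) z) = 0 := by
    have : ∀ j : ℕ, (balRel k H V M (n + 1)).mkQ ((cycL k H V M n ^ j : Module.End k _) z) = 0 := by
      intro j
      induction j with
      | zero => simpa using hz
      | succ j ih =>
        have := congrArg (balCycL k H V M n) ih
        rw [map_zero] at this
        rw [pow_succ', Module.End.mul_apply]
        exact this
    exact this n
  have h2 := mkQ_cycL_pow (H := H) (V := V) (M := M) n (cycR V M hS n z)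
  rw [pow_succ, Module.End.mul_apply, cycL_cycR, h1] at h2
  rw [Submodule.mem_comap, ← Submodule.Quotient.mk_eq_zero]
  exact h2.symm

variable (V M) in
/-- The operator induced by `cycR` on `M ⊗_H V^{⊗ (n+1)}`. -/
noncomputable def balCycR (hS : Function.Bijective (HopfAlgebra.antipode k : H →ₗ[k] H)) (n : ℕ) :
    Bal k H V M (n + 1) →ₗ[k] Bal k H V M (n + 1) :=
  (balRel k H V M (n + 1)).mapQ (balRel k H V M (n + 1)) (cycR V M hS n) (cycR_mem hS n)

end HopfActions
/-! ### The cyclic category and cocyclic modules -/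

/-- The objects `[0], [1], [2], …` of the cyclic category. -/
def CyclicQuiver : Type := ℕ

/-- The generators of the cyclic category: cofaces `d i : [n] ⟶ [n+1]`, codegeneracies
`s j : [n+1] ⟶ [n]`, and the cyclic operators `t : [n] ⟶ [n]`. -/
inductive CyclicQuiver.Hom : CyclicQuiver → CyclicQuiver → Type
  | d (n : ℕ) (i : Fin (n + 2)) : CyclicQuiver.Hom n (n + 1 : ℕ)
  | s (n : ℕ) (j : Fin (n + 1)) : CyclicQuiver.Hom (n + 1 : ℕ) n
  | t (n : ℕ) : CyclicQuiver.Hom n n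

instance : Quiver CyclicQuiver where
  Hom := CyclicQuiver.Hom

/-- The object `[n]` of the free category on the generators. -/
def pOb (n : ℕ) : Paths CyclicQuiver := (Paths.of CyclicQuiver).obj n

def pD {n : ℕ} (i : Fin (n + 2)) : pOb n ⟶ pOb (n + 1) :=
  (Paths.of CyclicQuiver).map (CyclicQuiver.Hom.d n i)

def pS {n : ℕ} (j : Fin (n + 1)) : pOb (n + 1) ⟶ pOb n :=
  (Paths.of CyclicQuiver).map (CyclicQuiver.Hom.s n j)

def pT (n : ℕ) : pOb n ⟶ pOb n :=
  (Paths.of CyclicQuiver).map (CyclicQuiver.Hom.t n)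

/-- The defining relations of the cyclic category (`f ≫ g` is `g ∘ f`): the cosimplicial
identities, the relations `t d_i = d_{i-1} t` and `t s_i = s_{i-1} t` for `i ≥ 1`,
`t d_0 = d_n`, `t s_0 = s_n t²`, and `t ^ (n+1) = 1` on `[n]`. -/
inductive CyclicRel : HomRel (Paths CyclicQuiver)
  | dd {n : ℕ} (i j : Fin (n + 2)) (h : i ≤ j) :
      CyclicRel (pD i ≫ pD j.succ) (pD j ≫ pD i.castSucc)
  | ds_lt {n : ℕ} (i : Fin (n + 2)) (j : Fin (n + 1)) (h : i ≤ j.castSucc) :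
      CyclicRel (pD i.castSucc ≫ pS j.succ) (pS j ≫ pD i)
  | ds_self {n : ℕ} (i : Fin (n + 1)) : CyclicRel (pD i.castSucc ≫ pS i) (𝟙 (pOb n))
  | ds_succ {n : ℕ} (i : Fin (n + 1)) : CyclicRel (pD i.succ ≫ pS i) (𝟙 (pOb n))
  | ds_gt {n : ℕ} (i : Fin (n + 2)) (j : Fin (n + 1)) (h : j.castSucc < i) :
      CyclicRel (pD i.succ ≫ pS j.castSucc) (pS j ≫ pD i)
  | ss {n : ℕ} (i j : Fin (n + 1)) (h : i ≤ j) :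
      CyclicRel (pS i.castSucc ≫ pS j) (pS j.succ ≫ pS i)
  | dt {n : ℕ} (i : Fin (n + 1)) : CyclicRel (pD i.succ ≫ pT (n + 1)) (pT n ≫ pD i.castSucc)
  | dt_zero {n : ℕ} : CyclicRel (pD 0 ≫ pT (n + 1)) (pD (Fin.last (n + 1)))
  | st {n : ℕ} (j : Fin (n + 1)) :
      CyclicRel (pS j.succ ≫ pT (n + 1)) (pT (n + 2) ≫ pS j.castSucc)
  | st_zero {n : ℕ} :
      CyclicRel (pS 0 ≫ pT n) (pT (n + 1) ≫ pT (n + 1) ≫ pS (Fin.last n))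
  | t_pow (n : ℕ) : CyclicRel ((End.of (pT n) ^ (n + 1) : End (pOb n))) (𝟙 (pOb n))

/-- Connes' cyclic category `ΔC`, by generators and relations. -/
abbrev CyclicCat : Type := CategoryTheory.Quotient CyclicRel

/-- The object `[n]` of the cyclic category. -/
def ob (n : ℕ) : CyclicCat := (CategoryTheory.Quotient.functor CyclicRel).obj (pOb n)

/-- The category of cocyclic `k`-modules. -/
abbrev CocyclicModule (k : Type u) [Field k] := CyclicCat ⥤ ModuleCat.{u} k

instance (k : Type u) [Field k] : HasExt.{u + 1} (CocyclicModule k) := HasExt.standard _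

/-- The cyclic cohomology `HC^n(X) = Ext^n_{ΔC}(k, X)` of a cocyclic module `X`, where `k` is the
constant cocyclic module (the unit for the levelwise tensor product). -/
noncomputable abbrev HC {k : Type u} [Field k] (n : ℕ) (X : CocyclicModule k) : Type (u + 1) :=
  Abelian.Ext.{u + 1} (𝟙_ (CocyclicModule k)) X n

section ExternalProduct

variable {k : Type u} [Field k] (X : CocyclicModule k)

instance : (tensorLeft X).Additive where
  map_add {Y Z f g} := by
    ext j : 2
    exact MonoidalPreadditive.whiskerLeft_add (f := f.app j) (g := g.app j)

instance : (tensorLeft X).Linear k where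
  map_smul f r := by
    ext j : 2
    exact MonoidalLinear.whiskerLeft_smul (X.obj j) r (f.app j)

instance : PreservesFiniteLimits (tensorLeft X) where
  preservesFiniteLimits J _ _ := preservesLimitsOfShape_of_evaluation _ _ fun c =>
    inferInstanceAs (PreservesLimitsOfShape J
      ((evaluation CyclicCat (ModuleCat.{u} k)).obj c ⋙ tensorLeft (X.obj c)))

instance : PreservesFiniteColimits (tensorLeft X) where
  preservesFiniteColimits J _ _ := preservesColimitsOfShape_of_evaluation _ _ fun c =>
    inferInstanceAs (PreservesColimitsOfShape J
      ((evaluation CyclicCat (ModuleCat.{u} k)).obj c ⋙ tensorLeft (X.obj c)))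

/-- The external product `HC^p(X) × HC^q(Y) → HC^{p+q}(diag(X ⊗ Y))`: the Yoneda composite of
`α : k → X[p]` with `X ⊗ β : X = X ⊗ k → (X ⊗ Y)[q]`, where the exact functor `X ⊗ -` is the
levelwise (diagonal) tensor product of cocyclic modules. -/
noncomputable def extProd {X Y : CocyclicModule k} {p q : ℕ} (α : HC p X) (β : HC q Y) :
    HC (p + q) (X ⊗ Y) :=
  α.comp ((Abelian.Ext.mk₀ (ρ_ X).inv).comp
    (Abelian.Ext.mapExactFunctor (tensorLeft X) β) (zero_add q)) rfl

/-- The map on cyclic cohomology induced by a morphism of cocyclic modules. -/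
noncomputable def HC.map {X Y : CocyclicModule k} (f : X ⟶ Y) {n : ℕ} (α : HC n X) : HC n Y :=
  α.comp (Abelian.Ext.mk₀ f) (add_zero n)

end ExternalProduct


/-! ### Cocyclic modules from operators -/

/-- Operators `e i` (`i ≤ n`), `s j` (`j ≤ n`) and `t` on a sequence of modules, which give a
cocyclic module whose cofaces `[n] → [n+1]` are `d_i = e i` for `i ≤ n` and `d_{n+1} = t ∘ d_0`. -/
structure CocyclicData (k : Type u) [Field k] where
  X : ℕ → ModuleCat.{u} k
  e : (n i : ℕ) → X n →ₗ[k] X (n + 1)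
  s : (n j : ℕ) → X (n + 1) →ₗ[k] X n
  t : (n : ℕ) → X n →ₗ[k] X n
  ee : ∀ n i j, i ≤ j → j ≤ n → ∀ x, e (n + 1) (j + 1) (e n i x) = e (n + 1) i (e n j x)
  es_lt : ∀ n i j, i ≤ j → j ≤ n → ∀ x, s (n + 1) (j + 1) (e (n + 1) i x) = e n i (s n j x)
  es_self : ∀ n i, i ≤ n → ∀ x, s n i (e n i x) = x
  es_succ : ∀ n i, i < n → ∀ x, s n i (e n (i + 1) x) = x
  es_last : ∀ n x, s n n (t (n + 1) (e n 0 x)) = x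
  es_gt : ∀ n i j, j < i → i ≤ n → ∀ x, s (n + 1) j (e (n + 1) (i + 1) x) = e n i (s n j x)
  ss : ∀ n i j, i ≤ j → j ≤ n → ∀ x, s n j (s (n + 1) i x) = s n i (s (n + 1) (j + 1) x)
  te : ∀ n i, i < n → ∀ x, t (n + 1) (e n (i + 1) x) = e n i (t n x)
  ts : ∀ n j, j ≤ n → ∀ x, t (n + 1) (s (n + 1) (j + 1) x) = s (n + 1) j (t (n + 2) x)
  ts_zero : ∀ n x, t n (s n 0 x) = s n n (t (n + 1) (t (n + 1) x))
  t_pow : ∀ n x, (t n ^ (n + 1) : Module.End k (X n)) x = x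

namespace CocyclicData

variable {k : Type u} [Field k] (D : CocyclicData k)

/-- The coface `d_i : X^n → X^{n+1}`. -/
noncomputable def d (n i : ℕ) : D.X n →ₗ[k] D.X (n + 1) :=
  if i ≤ n then D.e n i else D.t (n + 1) ∘ₗ D.e n 0

theorem d_of_le {n i : ℕ} (h : i ≤ n) (x : D.X n) : D.d n i x = D.e n i x := by simp [d, h]

theorem d_last (n : ℕ) (x : D.X n) : D.d n (n + 1) x = D.t (n + 1) (D.e n 0 x) := by simp [d]

theorem t_pow_e (n j : ℕ) (h : j ≤ n) (x : D.X n) :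
    (D.t (n + 1) ^ j : Module.End k _) (D.e n j x) = D.e n 0 ((D.t n ^ j : Module.End k _) x) := by
  induction j generalizing x with
  | zero => rfl
  | succ j ih =>
    rw [pow_succ, Module.End.mul_apply, D.te n j (by omega), ih (by omega), pow_succ,
      Module.End.mul_apply]

/-- `t² d_0 = d_n t`, that is, `t d_{n+1} = d_n t`. -/
theorem t_t_e (n : ℕ) (x : D.X n) : D.t (n + 1) (D.t (n + 1) (D.e n 0 x)) = D.e n n (D.t n x) := by
  have h1 := D.t_pow_e n n le_rfl (D.t n x)
  rw [← Module.End.mul_apply, ← pow_succ, D.t_pow] at h1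
  have h2 := D.t_pow (n + 1) (D.e n n (D.t n x))
  rw [pow_succ', pow_succ', Module.End.mul_apply, Module.End.mul_apply, h1] at h2
  exact h2

theorem dd (n i j : ℕ) (h : i ≤ j) (hj : j ≤ n + 1) (x : D.X n) :
    D.d (n + 1) (j + 1) (D.d n i x) = D.d (n + 1) i (D.d n j x) := by
  rcases hj.lt_or_eq with hj | rfl
  · rw [D.d_of_le (i := i) (by omega), D.d_of_le (by omega), D.d_of_le (i := i) (by omega),
      D.d_of_le (by omega), D.ee n i j h (by omega)]
  · rw [D.d_last (n + 1), D.d_last n, D.d_of_le (n := n + 1) (i := i) h]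
    rcases h.lt_or_eq with h | rfl
    · rw [D.d_of_le (by omega)]
      rcases i with _ | i
      · rw [← D.ee n 0 0 le_rfl (by omega), D.te (n + 1) 0 (by omega)]
      · rw [← D.te (n + 1) (i + 1) (by omega), D.ee n 0 (i + 1) (by omega) (by omega)]
    · rw [D.d_last, ← D.t_t_e (n + 1), ← D.te (n + 1) 0 (by omega), D.ee n 0 0 le_rfl (by omega)]

theorem ds_gt (n i j : ℕ) (h : j < i) (hi : i ≤ n + 1) (hj : j ≤ n) (x : D.X (n + 1)) :
    D.s (n + 1) j (D.d (n + 1) (i + 1) x) = D.d n i (D.s n j x) := by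
  rcases hi.lt_or_eq with hi | rfl
  · rw [D.d_of_le (by omega), D.d_of_le (by omega), D.es_gt n i j h (by omega)]
  · rw [D.d_last, D.d_last, ← D.ts n j hj, D.es_lt n 0 j (by omega) hj]

theorem ds_succ (n i : ℕ) (h : i ≤ n) (x : D.X n) : D.s n i (D.d n (i + 1) x) = x := by
  rcases h.lt_or_eq with h | rfl
  · rw [D.d_of_le (by omega), D.es_succ n i h]
  · rw [D.d_last, D.es_last]

theorem dt (n i : ℕ) (h : i ≤ n) (x : D.X n) :
    D.t (n + 1) (D.d n (i + 1) x) = D.d n i (D.t n x) := by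
  rcases h.lt_or_eq with h | rfl
  · rw [D.d_of_le (by omega), D.d_of_le (by omega), D.te n i h]
  · rw [D.d_last, D.d_of_le le_rfl, D.t_t_e]

/-- The operators as morphisms indexed by the generators of the cyclic category. -/
noncomputable def prefunctor : CyclicQuiver ⥤q ModuleCat.{u} k where
  obj n := D.X n
  map f := match f with
    | .d n i => ModuleCat.ofHom (D.d n i)
    | .s n j => ModuleCat.ofHom (D.s n j)
    | .t n => ModuleCat.ofHom (D.t n)

theorem map_pD {n : ℕ} (i : Fin (n + 2)) :
    (Paths.lift D.prefunctor).map (pD i) = ModuleCat.ofHom (D.d n i) := Paths.lift_toPath _ _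

theorem map_pS {n : ℕ} (j : Fin (n + 1)) :
    (Paths.lift D.prefunctor).map (pS j) = ModuleCat.ofHom (D.s n j) := Paths.lift_toPath _ _

theorem map_pT (n : ℕ) :
    (Paths.lift D.prefunctor).map (pT n) = ModuleCat.ofHom (D.t n) := Paths.lift_toPath _ _

theorem map_pT_pow (n m : ℕ) :
    (Paths.lift D.prefunctor).map (End.of (pT n) ^ m : End (pOb n)) =
      ModuleCat.ofHom (D.t n ^ m : Module.End k (D.X n)) := by
  induction m with
  | zero => exact (Paths.lift D.prefunctor).map_id _
  | succ m ih =>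
    have : ((End.of (pT n) ^ (m + 1) : End (pOb n)) : pOb n ⟶ pOb n) =
        pT n ≫ (End.of (pT n) ^ m : End (pOb n)) := by rw [pow_succ]; rfl
    rw [this, Functor.map_comp, ih, map_pT, pow_succ]
    rfl

/-- The cocyclic module defined by the operators. -/
noncomputable def toCocyclic : CocyclicModule k :=
  CategoryTheory.Quotient.lift CyclicRel (Paths.lift D.prefunctor) (by
    rintro X Y f g h
    induction h with
    | @dd n i j h =>
      simp only [Functor.map_comp, map_pD]
      ext x
      exact D.dd n i j h (Nat.le_of_lt_succ j.isLt) x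
    | @ds_lt n i j h =>
      simp only [Functor.map_comp, map_pD, map_pS]
      ext x
      have h' : (i : ℕ) ≤ j := h
      have hj : (j : ℕ) ≤ n := Nat.le_of_lt_succ j.isLt
      refine Eq.trans ?_ ((D.es_lt n i j h' hj x).trans ?_)
      · exact congrArg _ (D.d_of_le (show (i : ℕ) ≤ n + 1 by omega) x)
      · exact (D.d_of_le (show (i : ℕ) ≤ n by omega) _).symm
    | @ds_self n i =>
      simp only [Functor.map_comp, map_pD, map_pS]
      ext x
      have hi : (i : ℕ) ≤ n := Nat.le_of_lt_succ i.isLt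
      exact (congrArg _ (D.d_of_le hi x)).trans (D.es_self n i hi x)
    | @ds_succ n i =>
      simp only [Functor.map_comp, map_pD, map_pS]
      ext x
      exact D.ds_succ n i (Nat.le_of_lt_succ i.isLt) x
    | @ds_gt n i j h =>
      simp only [Functor.map_comp, map_pD, map_pS]
      ext x
      exact D.ds_gt n i j h (Nat.le_of_lt_succ i.isLt) (Nat.le_of_lt_succ j.isLt) x
    | @ss n i j h =>
      simp only [Functor.map_comp, map_pS]
      ext x
      exact D.ss n i j h (Nat.le_of_lt_succ j.isLt) x
    | @dt n i =>
      simp only [Functor.map_comp, map_pD, map_pT]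
      ext x
      exact D.dt n i (Nat.le_of_lt_succ i.isLt) x
    | @dt_zero n =>
      simp only [Functor.map_comp, map_pD, map_pT]
      ext x
      exact (congrArg _ (D.d_of_le (Nat.zero_le n) x)).trans (D.d_last n x).symm
    | @st n j =>
      simp only [Functor.map_comp, map_pS, map_pT]
      ext x
      exact D.ts n j (Nat.le_of_lt_succ j.isLt) x
    | @st_zero n =>
      simp only [Functor.map_comp, map_pS, map_pT]
      ext x
      exact D.ts_zero n x
    | t_pow n =>
      refine (map_pT_pow D n (n + 1)).trans
        (Eq.trans ?_ ((Paths.lift D.prefunctor).map_id _).symm)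
      ext x
      exact D.t_pow n x)

end CocyclicData

/-! ### The cocyclic modules of a module coalgebra, of a module algebra, and of an algebra -/

section HopfCocyclic

open Coalgebra TPow

variable {k : Type u} [Field k] {H V M : Type u} [Ring H] [HopfAlgebra k H]
  [AddCommGroup V] [Module k V] [Module H V] [IsScalarTower k H V]
  [AddCommGroup M] [Module k M] [Module Hᵐᵒᵖ M] [IsScalarTower k Hᵐᵒᵖ M]

theorem balMap_balMap {n m m' l : ℕ} {f : TPow k V n →ₗ[k] TPow k V m}
    {g : TPow k V m →ₗ[k] TPow k V l} {f' : TPow k V n →ₗ[k] TPow k V m'}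
    {g' : TPow k V m' →ₗ[k] TPow k V l} (hf hg hf' hg') (h : g ∘ₗ f = g' ∘ₗ f')
    (x : Bal k H V M n) :
    balMap g hg (balMap f hf x) = balMap g' hg' (balMap f' hf' x) := by
  obtain ⟨z, rfl⟩ := Submodule.mkQ_surjective _ x
  change (balRel k H V M l).mkQ (LinearMap.lTensor M g (LinearMap.lTensor M f z)) =
    (balRel k H V M l).mkQ (LinearMap.lTensor M g' (LinearMap.lTensor M f' z))
  rw [← LinearMap.lTensor_comp_apply, h, LinearMap.lTensor_comp_apply]

theorem balMap_balMap_id {n m : ℕ} {f : TPow k V n →ₗ[k] TPow k V m}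
    {g : TPow k V m →ₗ[k] TPow k V n} (hf hg) (h : g ∘ₗ f = LinearMap.id) (x : Bal k H V M n) :
    balMap g hg (balMap f hf x) = x := by
  obtain ⟨z, rfl⟩ := Submodule.mkQ_surjective _ x
  change (balRel k H V M n).mkQ (LinearMap.lTensor M g (LinearMap.lTensor M f z)) = _
  rw [← LinearMap.lTensor_comp_apply, h, LinearMap.lTensor_id]
  rfl

variable [SAYDModule k H M]

theorem twist_head_tail {n m : ℕ} (Φ : H →ₗ[k] V →ₗ[k] V) (g : TPow k V n →ₗ[k] TPow k V m)
    (z : M ⊗[k] TPow k V (n + 1)) :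
    twist M (head ∘ₗ Φ) (LinearMap.lTensor M (tail g) z) =
      LinearMap.lTensor M (tail g) (twist M (head ∘ₗ Φ) z) := by
  let K : H →ₗ[k] TPow k V (n + 1) →ₗ[k] TPow k V (m + 1) :=
    LinearMap.compRight k (tail g) ∘ₗ head ∘ₗ Φ
  have h1 := twist_comp_lTensor (M := M) (tail g) (head ∘ₗ Φ) K fun a x => by
    have : head (Φ a) ∘ₗ tail g = tail g ∘ₗ head (Φ a) := ext_cons fun v x => rfl
    exact LinearMap.congr_fun this x
  have h2 := lTensor_comp_twist (M := M) (tail g) (head ∘ₗ Φ) K fun a x => rfl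
  exact LinearMap.congr_fun (h1.trans h2.symm) z

theorem cycL_tail {n m : ℕ} (g : TPow k V n →ₗ[k] TPow k V m)
    (g' : TPow k V (n + 1) →ₗ[k] TPow k V (m + 1)) (h : rotL m ∘ₗ tail g = g' ∘ₗ rotL n)
    (z : M ⊗[k] TPow k V (n + 1)) :
    cycL k H V M m (LinearMap.lTensor M (tail g) z) =
      LinearMap.lTensor M g' (cycL k H V M n z) := by
  simp only [cycL, LinearMap.comp_apply, twist_head_tail]
  rw [← LinearMap.comp_apply, ← LinearMap.lTensor_comp, h, LinearMap.lTensor_comp]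
  rfl

theorem cycR_tail (hS : Function.Bijective (HopfAlgebra.antipode k : H →ₗ[k] H)) {n m : ℕ}
    (g : TPow k V n →ₗ[k] TPow k V m) (g' : TPow k V (n + 1) →ₗ[k] TPow k V (m + 1))
    (h : tail g ∘ₗ rotR n = rotR m ∘ₗ g') (z : M ⊗[k] TPow k V (n + 1)) :
    LinearMap.lTensor M (tail g) (cycR V M hS n z) =
      cycR V M hS m (LinearMap.lTensor M g' z) := by
  simp only [cycR, LinearMap.comp_apply, ← twist_head_tail]
  rw [← LinearMap.comp_apply (LinearMap.lTensor M (tail g)), ← LinearMap.lTensor_comp, h,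
    LinearMap.lTensor_comp]
  rfl

theorem balCycL_pow (n j : ℕ) (z : M ⊗[k] TPow k V (n + 1)) :
    (balCycL k H V M n ^ j : Module.End k _) ((balRel k H V M (n + 1)).mkQ z) =
      (balRel k H V M (n + 1)).mkQ ((cycL k H V M n ^ j : Module.End k _) z) := by
  induction j generalizing z with
  | zero => rfl
  | succ j ih =>
    rw [pow_succ, pow_succ, Module.End.mul_apply, Module.End.mul_apply, ← ih]
    rfl

theorem balCycL_pow_self (n : ℕ) (x : Bal k H V M (n + 1)) :
    (balCycL k H V M n ^ (n + 1) : Module.End k _) x = x := by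
  obtain ⟨z, rfl⟩ := Submodule.mkQ_surjective _ x
  rw [balCycL_pow, mkQ_cycL_pow]

theorem balCycL_balCycR (hS : Function.Bijective (HopfAlgebra.antipode k : H →ₗ[k] H)) (n : ℕ)
    (x : Bal k H V M (n + 1)) : balCycL k H V M n (balCycR V M hS n x) = x := by
  obtain ⟨z, rfl⟩ := Submodule.mkQ_surjective _ x
  exact congrArg (balRel k H V M (n + 1)).mkQ (cycL_cycR hS n z)

theorem balCycL_balCycR_pow (hS : Function.Bijective (HopfAlgebra.antipode k : H →ₗ[k] H))
    (n j : ℕ) (x : Bal k H V M (n + 1)) : (balCycL k H V M n ^ j : Module.End k _)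
      ((balCycR V M hS n ^ j : Module.End k _) x) = x := by
  induction j generalizing x with
  | zero => rfl
  | succ j ih =>
    rw [pow_succ, pow_succ', Module.End.mul_apply, Module.End.mul_apply, balCycL_balCycR, ih]

theorem balCycR_pow_self (hS : Function.Bijective (HopfAlgebra.antipode k : H →ₗ[k] H)) (n : ℕ)
    (x : Bal k H V M (n + 1)) : (balCycR V M hS n ^ (n + 1) : Module.End k _) x = x := by
  have := balCycL_balCycR_pow hS n (n + 1) x
  rwa [balCycL_pow_self] at this

theorem dualMap_pow {W : Type u} [AddCommGroup W] [Module k W] (f : Module.End k W) (j : ℕ)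
    (φ : Module.Dual k W) :
    (LinearMap.dualMap f ^ j : Module.End k (Module.Dual k W)) φ = φ ∘ₗ (f ^ j) := by
  induction j generalizing φ with
  | zero => rfl
  | succ j ih =>
    rw [pow_succ, Module.End.mul_apply, ih, pow_succ']
    rfl

section CoalgebraCase

variable {C : Type u} [AddCommGroup C] [Module k C] [Coalgebra k C] [Module H C]
  [IsScalarTower k H C] [HopfModuleCoalgebra k H C]

/-- The last codegeneracy after the cyclic operator is `m ⊗ c⁰ ⊗ x ↦ ε(c⁰) m ⊗ x`. -/
theorem del_last_cycL (n : ℕ) (z : M ⊗[k] TPow k C (n + 2)) :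
    LinearMap.lTensor M (del (n + 1) (n + 1)) (cycL k H C M (n + 1) z) =
      LinearMap.lTensor M (del (n + 1) 0) z := by
  let K : H →ₗ[k] TPow k C (n + 2) →ₗ[k] TPow k C (n + 1) :=
    LinearMap.compRight k (del (n + 1) (n + 1) ∘ₗ rotL (n + 1)) ∘ₗ head ∘ₗ act k (H := H) (V := C)
  have h1 := lTensor_comp_twist (M := M) (del (n + 1) (n + 1) ∘ₗ rotL (n + 1))
    (head ∘ₗ act k (H := H) (V := C)) K fun a x => rfl
  have h2 : ∀ h x, K h x = counit (R := k) h • del (n + 1) 0 x := by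
    intro h
    have : K h = counit (R := k) h • del (n + 1) 0 := ext_cons fun c x => by
      change del (n + 1) (n + 1) (rotL (n + 1) (cons (h • c) x)) =
        counit (R := k) h • del (n + 1) 0 (cons c x)
      rw [del_last_rotL, del_zero_cons, HopfModuleCoalgebra.counit_smul, mul_smul]
    exact LinearMap.congr_fun this
  rw [twist_counit (M := M) _ K h2, LinearMap.lTensor_comp] at h1
  exact LinearMap.congr_fun h1 z

/-- The operators on `C^n_H(C, M) = M ⊗_H C^{⊗ (n+1)}`: for `i ≤ n`,
`d_i(m ⊗ c⁰ ⊗ ⋯ ⊗ cⁿ) = m ⊗ c⁰ ⊗ ⋯ ⊗ cⁱ₍₁₎ ⊗ cⁱ₍₂₎ ⊗ ⋯ ⊗ cⁿ`, and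
`s_j(m ⊗ c⁰ ⊗ ⋯ ⊗ c^{n+1}) = ε(c^{j+1}) m ⊗ c⁰ ⊗ ⋯ ⊗ c^j ⊗ c^{j+2} ⊗ ⋯ ⊗ c^{n+1}`,
`t(m ⊗ c⁰ ⊗ ⋯ ⊗ cⁿ) = m₍₀₎ ⊗ c¹ ⊗ ⋯ ⊗ cⁿ ⊗ m₍₋₁₎c⁰`. Hence the last coface `t d_0` is
`m ⊗ c⁰ ⊗ ⋯ ⊗ cⁿ ↦ m₍₀₎ ⊗ c⁰₍₂₎ ⊗ c¹ ⊗ ⋯ ⊗ cⁿ ⊗ m₍₋₁₎c⁰₍₁₎`. -/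
noncomputable def coalgebraData (k H C M : Type u) [Field k] [Ring H] [HopfAlgebra k H]
    [AddCommGroup C] [Module k C] [Coalgebra k C] [Module H C] [IsScalarTower k H C]
    [HopfModuleCoalgebra k H C] [AddCommGroup M] [Module k M] [Module Hᵐᵒᵖ M]
    [IsScalarTower k Hᵐᵒᵖ M] [SAYDModule k H M] :
    CocyclicData k where
  X n := ModuleCat.of k (Bal k H C M (n + 1))
  e n i := balMap (split (n + 1) i) fun h => rho_split h (n + 1) i
  s n j := balMap (del (n + 1) (j + 1)) fun h => rho_del h (n + 1) (j + 1)
  t n := balCycL k H C M n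
  ee n i j h hj := balMap_balMap _ _ _ _ (split_split (n + 1) i j h (by omega))
  es_lt n i j h hj := balMap_balMap _ _ _ _ (del_split_lt (n + 1) i (j + 1) (by omega) (by omega))
  es_self n i h := balMap_balMap_id _ _ (del_split_succ (n + 1) i (by omega))
  es_succ n i h := balMap_balMap_id _ _ (del_split_self (n + 1) (i + 1) (by omega))
  es_last n x := by
    obtain ⟨z, rfl⟩ := Submodule.mkQ_surjective _ x
    refine congrArg (balRel k H C M (n + 1)).mkQ ((del_last_cycL n _).trans ?_)
    rw [← LinearMap.comp_apply, ← LinearMap.lTensor_comp, del_split_self (n + 1) 0 (by omega),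
      LinearMap.lTensor_id, LinearMap.id_apply]
  es_gt n i j h hi := balMap_balMap _ _ _ _ (del_split_gt (n + 1) i (j + 1) (by omega) (by omega))
  ss n i j h hj := balMap_balMap _ _ _ _ (del_del (n + 1) (i + 1) (j + 1) (by omega) (by omega))
  te n i h x := by
    obtain ⟨z, rfl⟩ := Submodule.mkQ_surjective _ x
    exact congrArg (balRel k H C M (n + 2)).mkQ
      (cycL_tail (split n i) (split (n + 1) i) (rotL_split n i h) z)
  ts n j h x := by
    obtain ⟨z, rfl⟩ := Submodule.mkQ_surjective _ x
    exact congrArg (balRel k H C M (n + 2)).mkQ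
      (cycL_tail (del (n + 1) (j + 1)) (del (n + 2) (j + 1)) (rotL_del (n + 1) (j + 1) (by omega)) z)
  ts_zero n x := by
    obtain ⟨z, rfl⟩ := Submodule.mkQ_surjective _ x
    exact congrArg (balRel k H C M (n + 1)).mkQ
      ((cycL_tail (del n 0) (del (n + 1) 0) (rotL_del n 0 (by omega)) z).trans
        (del_last_cycL n _).symm)
  t_pow n x := balCycL_pow_self n x

/-- The cocyclic module `C^*_H(C, M)` of a module coalgebra. -/
noncomputable def cocyclicCoalg (k H C M : Type u) [Field k] [Ring H] [HopfAlgebra k H]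
    [AddCommGroup C] [Module k C] [Coalgebra k C] [Module H C] [IsScalarTower k H C]
    [HopfModuleCoalgebra k H C] [AddCommGroup M] [Module k M] [Module Hᵐᵒᵖ M]
    [IsScalarTower k Hᵐᵒᵖ M] [SAYDModule k H M] :
    CocyclicModule k := (coalgebraData k H C M).toCocyclic

end CoalgebraCase

section AlgebraCase

variable {A : Type u} [Ring A] [Algebra k A]

/-- The operators on `C^n(A) = Hom(A^{⊗ (n+1)}, k)`: for `i ≤ n`,
`(d_i φ)(a₀ ⊗ ⋯ ⊗ a_{n+1}) = φ(a₀ ⊗ ⋯ ⊗ aᵢaᵢ₊₁ ⊗ ⋯ ⊗ a_{n+1})`, and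
`(s_j φ)(a₀ ⊗ ⋯ ⊗ aₙ) = φ(a₀ ⊗ ⋯ ⊗ a_j ⊗ 1 ⊗ a_{j+1} ⊗ ⋯ ⊗ aₙ)`,
`(t φ)(a₀ ⊗ ⋯ ⊗ aₙ) = φ(aₙ ⊗ a₀ ⊗ ⋯ ⊗ a_{n-1})`. Hence `(t d_0 φ)(a₀ ⊗ ⋯ ⊗ a_{n+1})` is
`φ(a_{n+1}a₀ ⊗ a₁ ⊗ ⋯ ⊗ aₙ)`. -/
noncomputable def algebraData (k : Type u) [Field k] (A : Type u) [Ring A] [Algebra k A] :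
    CocyclicData k where
  X n := ModuleCat.of k (Module.Dual k (TPow k A (n + 1)))
  e n i := (merge n i).dualMap
  s n j := (ins (n + 1) (j + 1)).dualMap
  t n := (rotR n).dualMap
  ee n i j h hj φ := congrArg (φ ∘ₗ ·) (merge_merge n i j h hj)
  es_lt n i j h hj φ := congrArg (φ ∘ₗ ·) (merge_ins_lt n i (j + 1) (by omega) (by omega))
  es_self n i h φ := congrArg (φ ∘ₗ ·) (merge_ins_succ n i h)
  es_succ n i h φ := congrArg (φ ∘ₗ ·) (merge_ins_self n (i + 1) h)
  es_last n φ := by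
    refine LinearMap.ext fun x => congrArg φ ?_
    change merge n 0 (rotR (n + 1) (ins (n + 1) (n + 1) x)) = x
    rw [rotR_ins_last]
    exact LinearMap.congr_fun (merge_ins_self n 0 (by omega)) x
  es_gt n i j h hi φ := congrArg (φ ∘ₗ ·) (merge_ins_gt n i (j + 1) h hi)
  ss n i j h hj φ := congrArg (φ ∘ₗ ·) (ins_ins (n + 1) (i + 1) (j + 1) (by omega) (by omega))
  te n i h φ := congrArg (φ ∘ₗ ·) (rotR_merge n i h)
  ts n j h φ := congrArg (φ ∘ₗ ·) (rotR_ins (n + 1) (j + 1) (by omega))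
  ts_zero n φ := by
    refine LinearMap.ext fun x => congrArg φ ?_
    change ins (n + 1) 1 (rotR n x) = rotR (n + 1) (rotR (n + 1) (ins (n + 1) (n + 1) x))
    rw [rotR_ins_last]
    exact LinearMap.congr_fun (rotR_ins n 0 (by omega)) x
  t_pow n φ := by
    have h : ∀ (j : ℕ) (x : TPow k A (n + 1)), (rotL n ^ j : Module.End k _)
        ((rotR n ^ j : Module.End k _) x) = x := by
      intro j
      induction j with
      | zero => intro x; rfl
      | succ j ih =>
        intro x
        rw [pow_succ, pow_succ', Module.End.mul_apply, Module.End.mul_apply,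
          show rotL n (rotR n _) = _ from LinearMap.congr_fun (rotL_rotR (k := k) (V := A) n) _]
        exact ih x
    refine (dualMap_pow _ _ φ).trans (LinearMap.ext fun x => congrArg φ ?_)
    have := h (n + 1) x
    rwa [rotL_pow_self] at this

/-- The cocyclic module `C^*(A)` of an algebra, whose cohomology is the ordinary cyclic cohomology
`HC^*(A)`. -/
noncomputable def cocyclicOrd (k : Type u) [Field k] (A : Type u) [Ring A] [Algebra k A] :
    CocyclicModule k := (algebraData k A).toCocyclic

variable [Module H A] [IsScalarTower k H A] [HopfModuleAlgebra k H A]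

theorem cycR_ins_last (hS : Function.Bijective (HopfAlgebra.antipode k : H →ₗ[k] H)) (n : ℕ)
    (z : M ⊗[k] TPow k A (n + 1)) :
    cycR A M hS (n + 1) (LinearMap.lTensor M (ins (n + 1) (n + 1)) z) =
      LinearMap.lTensor M (ins (n + 1) 0) z := by
  have h1 := twist_comp_lTensor (M := M) (rotR (n + 1) ∘ₗ ins (n + 1) (n + 1))
    (head ∘ₗ act k (H := H) (V := A) ∘ₗ (antipodeEquiv hS).symm.toLinearMap)
    ((counit (R := k) (A := H)).smulRight (ins (n + 1) 0)) fun h x => by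
      have h2 : counit (R := k) ((antipodeEquiv hS).symm h) = counit (R := k) h := by
        conv_rhs => rw [← (antipodeEquiv hS).apply_symm_apply h]
        exact (HopfAlgebra.counit_antipode _).symm
      have h3 : (rotR (n + 1) ∘ₗ ins (n + 1) (n + 1)) x = cons (1 : A) x := rotR_ins_last (n + 1) x
      rw [h3]
      change cons ((antipodeEquiv hS).symm h • (1 : A)) x = counit (R := k) h • cons 1 x
      rw [HopfModuleAlgebra.smul_one (k := k), h2, map_smul, LinearMap.smul_apply]
  rw [twist_counit (M := M) (ins (n + 1) 0) _ fun h x => rfl, LinearMap.lTensor_comp] at h1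
  exact LinearMap.congr_fun h1 z

/-- The operators on `C^n_H(A, M) = Hom_k(M ⊗_H A^{⊗ (n+1)}, k)`: for `i ≤ n`,
`(d_i φ)(m ⊗ a₀ ⊗ ⋯ ⊗ a_{n+1}) = φ(m ⊗ a₀ ⊗ ⋯ ⊗ aᵢaᵢ₊₁ ⊗ ⋯ ⊗ a_{n+1})`, and
`(s_j φ)(m ⊗ a₀ ⊗ ⋯ ⊗ aₙ) = φ(m ⊗ a₀ ⊗ ⋯ ⊗ a_j ⊗ 1 ⊗ a_{j+1} ⊗ ⋯ ⊗ aₙ)`,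
`(t φ)(m ⊗ a₀ ⊗ ⋯ ⊗ aₙ) = φ(m₍₀₎ ⊗ S⁻¹(m₍₋₁₎)aₙ ⊗ a₀ ⊗ ⋯ ⊗ a_{n-1})`. Hence
`(t d_0 φ)(m ⊗ a₀ ⊗ ⋯ ⊗ a_{n+1}) = φ(m₍₀₎ ⊗ (S⁻¹(m₍₋₁₎)a_{n+1})a₀ ⊗ a₁ ⊗ ⋯ ⊗ aₙ)`. -/
noncomputable def moduleAlgebraData (A M : Type u) [Ring A] [Algebra k A] [Module H A]
    [IsScalarTower k H A] [HopfModuleAlgebra k H A] [AddCommGroup M] [Module k M]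
    [Module Hᵐᵒᵖ M] [IsScalarTower k Hᵐᵒᵖ M] [SAYDModule k H M]
    (hS : Function.Bijective (HopfAlgebra.antipode k : H →ₗ[k] H)) : CocyclicData k where
  X n := ModuleCat.of k (Module.Dual k (Bal k H A M (n + 1)))
  e n i := (balMap (merge n i) fun h => rho_merge h n i).dualMap
  s n j := (balMap (ins (n + 1) (j + 1)) fun h => rho_ins h (n + 1) (j + 1)).dualMap
  t n := (balCycR A M hS n).dualMap
  ee n i j h hj φ := LinearMap.ext fun x => congrArg φ <|
    balMap_balMap _ _ _ _ (merge_merge n i j h hj) x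
  es_lt n i j h hj φ := LinearMap.ext fun x => congrArg φ <|
    balMap_balMap _ _ _ _ (merge_ins_lt n i (j + 1) (by omega) (by omega)) x
  es_self n i h φ := LinearMap.ext fun x => congrArg φ <|
    balMap_balMap_id _ _ (merge_ins_succ n i h) x
  es_succ n i h φ := LinearMap.ext fun x => congrArg φ <|
    balMap_balMap_id _ _ (merge_ins_self n (i + 1) h) x
  es_last n φ := by
    refine LinearMap.ext fun x => congrArg φ ?_
    obtain ⟨z, rfl⟩ := Submodule.mkQ_surjective _ x
    refine congrArg (balRel k H A M (n + 1)).mkQ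
      ((congrArg (LinearMap.lTensor M (merge n 0)) (cycR_ins_last hS n z)).trans ?_)
    rw [← LinearMap.comp_apply, ← LinearMap.lTensor_comp, merge_ins_self n 0 (by omega),
      LinearMap.lTensor_id, LinearMap.id_apply]
  es_gt n i j h hi φ := LinearMap.ext fun x => congrArg φ <|
    balMap_balMap _ _ _ _ (merge_ins_gt n i (j + 1) h hi) x
  ss n i j h hj φ := LinearMap.ext fun x => congrArg φ <|
    balMap_balMap _ _ _ _ (ins_ins (n + 1) (i + 1) (j + 1) (by omega) (by omega)) x
  te n i h φ := by
    refine LinearMap.ext fun x => congrArg φ ?_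
    obtain ⟨z, rfl⟩ := Submodule.mkQ_surjective _ x
    obtain _ | n := n
    · omega
    · exact congrArg (balRel k H A M (n + 2)).mkQ
        (cycR_tail hS (merge n i) (merge (n + 1) i) (rotR_merge (n + 1) i h) z)
  ts n j h φ := by
    refine LinearMap.ext fun x => congrArg φ ?_
    obtain ⟨z, rfl⟩ := Submodule.mkQ_surjective _ x
    exact congrArg (balRel k H A M (n + 3)).mkQ
      (cycR_tail hS (ins (n + 1) (j + 1)) (ins (n + 2) (j + 1))
        (rotR_ins (n + 1) (j + 1) (by omega)) z)
  ts_zero n φ := by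
    refine LinearMap.ext fun x => congrArg φ ?_
    obtain ⟨z, rfl⟩ := Submodule.mkQ_surjective _ x
    exact congrArg (balRel k H A M (n + 2)).mkQ
      ((cycR_tail hS (ins n 0) (ins (n + 1) 0) (rotR_ins n 0 (by omega)) z).trans
        (congrArg (cycR A M hS (n + 1)) (cycR_ins_last hS n z).symm))
  t_pow n φ := (dualMap_pow _ _ φ).trans <| LinearMap.ext fun x => congrArg φ <|
    balCycR_pow_self hS n x

/-- The cocyclic module `C^*_H(A, M)` of a module algebra. -/
noncomputable def cocyclicAlg (A M : Type u) [Ring A] [Algebra k A] [Module H A]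
    [IsScalarTower k H A] [HopfModuleAlgebra k H A] [AddCommGroup M] [Module k M]
    [Module Hᵐᵒᵖ M] [IsScalarTower k Hᵐᵒᵖ M] [SAYDModule k H M]
    (hS : Function.Bijective (HopfAlgebra.antipode k : H →ₗ[k] H)) : CocyclicModule k :=
  (moduleAlgebraData A M hS).toCocyclic

end AlgebraCase

end HopfCocyclic

section Pairing

variable {k H C A M : Type u} [Field k] [Ring H] [HopfAlgebra k H]
  [AddCommGroup C] [Module k C] [Coalgebra k C] [Module H C] [IsScalarTower k H C]
  [HopfModuleCoalgebra k H C] [Ring A] [Algebra k A] [Module H A] [IsScalarTower k H A]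
  [HopfModuleAlgebra k H A] [AddCommGroup M] [Module k M] [Module Hᵐᵒᵖ M]
  [IsScalarTower k Hᵐᵒᵖ M] [SAYDModule k H M]

/-- The component in degree `n` of a morphism `diag(C^*_H(C, M) ⊗ C^*_H(A, M)) → C^*(A)`. -/
noncomputable def level {hS : Function.Bijective (HopfAlgebra.antipode k : H →ₗ[k] H)}
    (Ψ : cocyclicCoalg k H C M ⊗ cocyclicAlg A M hS ⟶ cocyclicOrd k A) (n : ℕ) :
    Bal k H C M (n + 1) ⊗[k] Module.Dual k (Bal k H A M (n + 1)) →ₗ[k]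
      Module.Dual k (TPow k A (n + 1)) := (Ψ.app (ob n)).hom

end Pairing

end HopfCyclic

open HopfCyclic

/-! Let `zip` denote the application of C^{⊗n} to A^{⊗n} factor by factor. In degree n, Ψ sends (m ⊗
c) ⊗ φ to the functional a ↦ φ(m ⊗ `zip` c a), with n + 1 factors in c and a. Every property of Ψ is
therefore a property of `zip`, and each axiom of the action answers for one kind of structure map.

The rule c(ab) = (c₍₁₎a)(c₍₂₎b) says that multiplying two neighbouring factors on the A side is
adjoint to splitting a factor on the C side (`merge_zip`). The rule c1 = ε(c)1 says that inserting a
unit is adjoint to deleting a factor by the counit (`ins_zip`). The rule h(ca) = (hc)a makes `zip`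
H-linear in its C variable while the A variable stays passive (`rho_zip`). Hence, for each fixed a,
the map m ⊗ c ↦ m ⊗ `zip` c a descends to a map of balanced tensor products (`balZip`).

The cyclic operator is the only generator that touches the coefficients. On the C side it rotates to
the left and twists by m₍₋₁₎; on the A side it is dual to a rotation to the right, twisted by
S⁻¹(m₍₋₁₎). When c and a are rotated to the left together, the twist passes from c⁰ to c⁰ ▹ a₀, so
`balZip` intertwines the C-side operator with the left rotation of M ⊗_H A^{⊗(n+1)}
(`balZip_balCycL`). The right rotation is inverse to this left rotation. The two twists cancel, and
the untwisted rotation of a, which is the cyclic operator of C^•(A), remains (`balCycR_balZip`).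

The last coface is t d_0 in all three modules, so it follows from the other generators. Every
morphism of the cyclic category is a composite of generators, so compatibility with these operators
makes the levelwise pairings a morphism of cocyclic modules (`pairing_naturality`, `pairing`).

On cohomology no cochain formula is needed. Yoneda composition is k-bilinear. Since k is a field and
the tensor product is levelwise, X ⊗ − is exact and k-linear, so it acts k-linearly on Ext. Thus (α,
β) ↦ Ψ_*(α × β) is bilinear and factors through the tensor product (`cupProduct`). -/

namespace HopfCyclic

/-! ### Morphisms of cocyclic modules from the generating operators -/

/-- A family of morphisms between functors on a free category is natural as soon as it is so with
respect to the generators. -/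
theorem paths_naturality {V : Type*} [Quiver V] {𝒞 : Type*} [Category 𝒞] {F G : Paths V ⥤ 𝒞}
    (τ : ∀ a, F.obj a ⟶ G.obj a)
    (h : ∀ {a b : V} (q : a ⟶ b), F.map ((Paths.of V).map q) ≫ τ ((Paths.of V).obj b) =
      τ ((Paths.of V).obj a) ≫ G.map ((Paths.of V).map q))
    {a b : Paths V} (g : a ⟶ b) : F.map g ≫ τ b = τ a ≫ G.map g := by
  induction g using Paths.induction with
  | id => simp
  | comp g q ih => rw [Functor.map_comp, Category.assoc, h, reassoc_of% ih, Functor.map_comp]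

namespace CocyclicData

variable {k : Type u} [Field k]

/-- Levelwise pairings that commute with the operators commute with the generators of the cyclic
category. -/
theorem pairing_naturality (D E F : CocyclicData k)
    (f : ∀ n, D.X n ⊗[k] E.X n →ₗ[k] F.X n)
    (he : ∀ n i, i ≤ n → ∀ x y, f (n + 1) (D.e n i x ⊗ₜ E.e n i y) = F.e n i (f n (x ⊗ₜ y)))
    (hs : ∀ n j, j ≤ n → ∀ x y, f n (D.s n j x ⊗ₜ E.s n j y) = F.s n j (f (n + 1) (x ⊗ₜ y)))
    (ht : ∀ n x y, f n (D.t n x ⊗ₜ E.t n y) = F.t n (f n (x ⊗ₜ y)))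
    {a b : ℕ} (q : CyclicQuiver.Hom a b) :
    (D.prefunctor.map q ⊗ₘ E.prefunctor.map q) ≫ ModuleCat.ofHom (f b) =
      ModuleCat.ofHom (f a) ≫ F.prefunctor.map q := by
  cases q with
  | d n i =>
    have key : ∀ x y, f (a + 1) (D.d a i x ⊗ₜ E.d a i y) = F.d a i (f a (x ⊗ₜ y)) := by
      intro x y
      -- For i ≤ n the coface is the operator `e` in all three modules and `he` applies. The
      -- remaining coface i = n + 1 is t d_0 in all three, so `ht` in degree n + 1 followed by `he`
      -- at index 0 settles it.
      rcases (Nat.le_of_lt_succ i.isLt).lt_or_eq with hi | hi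
      · rw [d_of_le _ (by omega), d_of_le _ (by omega), d_of_le _ (by omega), he a i (by omega)]
      · rw [hi, d_last, d_last, d_last, ht, he a 0 (by omega)]
    exact ModuleCat.hom_ext (TensorProduct.ext' key)
  | s n j =>
    exact ModuleCat.hom_ext (TensorProduct.ext' fun x y => hs _ j (Nat.le_of_lt_succ j.isLt) x y)
  | t n => exact ModuleCat.hom_ext (TensorProduct.ext' fun x y => ht _ x y)

/-- The morphism of cocyclic modules given by levelwise pairings that commute with the
operators. -/
noncomputable def pairing (D E F : CocyclicData k)
    (f : ∀ n, D.X n ⊗[k] E.X n →ₗ[k] F.X n)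
    (he : ∀ n i, i ≤ n → ∀ x y, f (n + 1) (D.e n i x ⊗ₜ E.e n i y) = F.e n i (f n (x ⊗ₜ y)))
    (hs : ∀ n j, j ≤ n → ∀ x y, f n (D.s n j x ⊗ₜ E.s n j y) = F.s n j (f (n + 1) (x ⊗ₜ y)))
    (ht : ∀ n x y, f n (D.t n x ⊗ₜ E.t n y) = F.t n (f n (x ⊗ₜ y))) :
    D.toCocyclic ⊗ E.toCocyclic ⟶ F.toCocyclic :=
  -- The relations of the cyclic category constrain functors, not transformations between them. It
  -- therefore suffices to be natural on the free category, and there on generators.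
  CategoryTheory.Quotient.natTransLift CyclicRel
    { app := fun n => ModuleCat.ofHom (f n)
      naturality := fun _ _ g => paths_naturality
        (F := CategoryTheory.Quotient.functor CyclicRel ⋙ (D.toCocyclic ⊗ E.toCocyclic))
        (G := CategoryTheory.Quotient.functor CyclicRel ⋙ F.toCocyclic)
        (fun n => ModuleCat.ofHom (f n))
        (fun {a b} q => by
          have h : ∀ X : CocyclicData k, (Paths.lift X.prefunctor).map
              ((Paths.of CyclicQuiver).map q) = X.prefunctor.map q := fun X =>
            Paths.lift_toPath X.prefunctor q
          -- The diagonal tensor product sends a generator to the tensor product of its two values,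
          -- and each of these values is the corresponding operator.
          refine Eq.trans (congrArg (· ≫ ModuleCat.ofHom (f b))
            (congrArg₂ (fun u v => u ⊗ₘ v) (h D) (h E))) ?_
          exact (pairing_naturality D E F f he hs ht q).trans
            (congrArg (ModuleCat.ofHom (f a) ≫ ·) (h F).symm)) g }

end CocyclicData

/-! ### Factorwise application on tensor powers -/

section DiagonalAction

open Coalgebra TPow

variable {k : Type u} [Field k] {C A : Type u} [AddCommGroup C] [Module k C] [AddCommGroup A]
  [Module k A]

/-- The factorwise application
`(c⁰ ⊗ ⋯ ⊗ c^{n-1}, a₀ ⊗ ⋯ ⊗ a_{n-1}) ↦ B(c⁰, a₀) ⊗ ⋯ ⊗ B(c^{n-1}, a_{n-1})`. -/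
noncomputable def TPow.zip (B : C →ₗ[k] A →ₗ[k] A) :
    (n : ℕ) → TPow k C n →ₗ[k] TPow k A n →ₗ[k] TPow k A n
  | 0 => elim0 LinearMap.id
  | n + 1 => TensorProduct.homTensorHomMap (.id k) A (TPow k A n) A (TPow k A n) ∘ₗ
      TensorProduct.map B (TPow.zip B n)

theorem TPow.zip_nil (B : C →ₗ[k] A →ₗ[k] A) (x : TPow k A 0) : zip B 0 nil x = x :=
  LinearMap.congr_fun (elim0_nil (V := C) (LinearMap.id : TPow k A 0 →ₗ[k] TPow k A 0)) x

theorem TPow.zip_cons (B : C →ₗ[k] A →ₗ[k] A) {n : ℕ} (c : C) (x : TPow k C n) (a : A)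
    (y : TPow k A n) : zip B (n + 1) (cons c x) (cons a y) = cons (B c a) (zip B n x y) := rfl

/-- Links the recursive definition of `zip` to the explicit formula for Ψ on pure tensors. -/
theorem TPow.zip_pure (B : C →ₗ[k] A →ₗ[k] A) : (n : ℕ) → (c : Fin n → C) → (a : Fin n → A) →
    zip B n (pure c) (pure a) = pure fun i => B (c i) (a i)
  | 0, _, _ => zip_nil B _
  | n + 1, c, a => by
      rw [pure_succ, pure_succ, zip_cons, zip_pure B n]
      rfl

/-- A factorwise operation does not see a permutation applied to the factors of both arguments at
once. This is the untwisted part of the compatibility with the cyclic operators. -/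
theorem TPow.zip_rotL (B : C →ₗ[k] A →ₗ[k] A) : (n : ℕ) → (x : TPow k C (n + 1)) →
    (y : TPow k A (n + 1)) → zip B (n + 1) (rotL n x) (rotL n y) = rotL n (zip B (n + 1) x y)
  | 0, _, _ => rfl
  | n + 1, x, y => by
      -- Stated as an equality of bilinear maps, the claim can be tested on tensors. Two leading
      -- factors are exposed in each variable because the rotation carries the first factor past the
      -- second and then recurses.
      suffices e : (zip B (n + 2)).compl₁₂ (rotL (n + 1)) (rotL (n + 1)) =
          (zip B (n + 2)).compr₂ (rotL (n + 1)) from LinearMap.congr_fun₂ e x y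
      refine ext_cons₂ fun c d x => ext_cons₂ fun a b y => ?_
      simp only [LinearMap.compl₁₂_apply, LinearMap.compr₂_apply, rotL_cons, zip_cons]
      rw [zip_rotL B n, zip_cons]

end DiagonalAction

/-! ### The action axioms as adjunctions between structure maps -/

namespace EquivariantAction

open Coalgebra TPow

set_option linter.unusedSectionVars false

variable {k H C A M : Type u} [Field k] [Ring H] [HopfAlgebra k H]
  [AddCommGroup C] [Module k C] [Coalgebra k C] [Module H C]
  [Ring A] [Algebra k A] [Module H A] (σ : EquivariantAction k H C A)

/-- At i = 0 this is the rule c(ab) = (c₍₁₎a)(c₍₂₎b) in the leading factor. For larger i both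
structure maps leave the leading factor alone, and induction applies to the rest. -/
theorem merge_zip : (n i : ℕ) → i ≤ n → (x : TPow k C (n + 1)) → (y : TPow k A (n + 2)) →
    merge n i (zip σ.act (n + 2) (split (n + 1) i x) y) = zip σ.act (n + 1) x (merge n i y)
  | n, 0, _, x, y => by
      suffices e : ((zip σ.act (n + 2)).comp (split (n + 1) 0)).compr₂ (merge n 0) =
          (zip σ.act (n + 1)).compl₁₂ LinearMap.id (merge n 0) from LinearMap.congr_fun₂ e x y
      refine ext_cons fun c x => ext_cons₂ fun a b y => ?_
      simp only [LinearMap.compl₁₂_apply, LinearMap.compr₂_apply, LinearMap.comp_apply,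
        LinearMap.id_apply, split_zero_cons, sweedler_map, sweedler_apply, zip_cons,
        merge_zero_cons, σ.act_mul]
  | n + 1, i + 1, h, x, y => by
      suffices e : ((zip σ.act (n + 3)).comp (split (n + 2) (i + 1))).compr₂
            (merge (n + 1) (i + 1)) =
          (zip σ.act (n + 2)).compl₁₂ LinearMap.id (merge (n + 1) (i + 1)) from
        LinearMap.congr_fun₂ e x y
      refine ext_cons fun c x => ext_cons fun a y => ?_
      simp only [LinearMap.compl₁₂_apply, LinearMap.compr₂_apply, LinearMap.comp_apply,
        LinearMap.id_apply, split_succ_cons, zip_cons, merge_succ_cons]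
      rw [merge_zip n i (by omega)]

/-- The factor of x at position j meets the inserted unit, where c1 = ε(c)1. The scalar ε(c) then
comes out of the tensor, which is what deleting that factor of x does. -/
theorem ins_zip : (n j : ℕ) → j ≤ n → (x : TPow k C (n + 1)) → (y : TPow k A n) →
    ins n j (zip σ.act n (del n j x) y) = zip σ.act (n + 1) x (ins n j y)
  | n, 0, _, x, y => by
      suffices e : ((zip σ.act n).comp (del n 0)).compr₂ (ins n 0) =
          (zip σ.act (n + 1)).compl₁₂ LinearMap.id (ins n 0) from LinearMap.congr_fun₂ e x y
      refine ext_cons fun c x => LinearMap.ext fun y => ?_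
      simp only [LinearMap.compl₁₂_apply, LinearMap.compr₂_apply, LinearMap.comp_apply,
        LinearMap.id_apply, del_zero_cons, zip_cons, ins_zero, σ.act_one, map_smul,
        LinearMap.smul_apply]
  | n + 1, j + 1, h, x, y => by
      suffices e : ((zip σ.act (n + 1)).comp (del (n + 1) (j + 1))).compr₂ (ins (n + 1) (j + 1)) =
          (zip σ.act (n + 2)).compl₁₂ LinearMap.id (ins (n + 1) (j + 1)) from
        LinearMap.congr_fun₂ e x y
      refine ext_cons fun c x => ext_cons fun a y => ?_
      simp only [LinearMap.compl₁₂_apply, LinearMap.compr₂_apply, LinearMap.comp_apply,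
        LinearMap.id_apply, del_succ_cons, zip_cons, ins_succ_cons]
      rw [ins_zip n j (by omega)]

/-! ### H-linearity of the factorwise action -/

variable [IsScalarTower k H C] [IsScalarTower k H A]

/-- Both diagonal actions distribute the same iterated coproduct of h over the factors, so h(ca) =
(hc)a can be applied in each factor separately. Here h does not act on y; this one-sided linearity
is what the balancing relations require. -/
theorem rho_zip : (n : ℕ) → (h : H) → (x : TPow k C n) → (y : TPow k A n) →
    zip σ.act n (rho k H C n h x) y = rho k H A n h (zip σ.act n x y)
  | 0, h, x, y => by
      rw [rho_zero, rho_zero, map_smul, LinearMap.smul_apply]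
  | n + 1, h, x, y => by
      suffices e : (zip σ.act (n + 1)).comp (rho k H C (n + 1) h) =
          (zip σ.act (n + 1)).compr₂ (rho k H A (n + 1) h) from LinearMap.congr_fun₂ e x y
      refine ext_cons fun c x => ext_cons fun a y => ?_
      simp only [LinearMap.compr₂_apply, LinearMap.comp_apply, zip_cons, rho_cons, sweedler_map,
        sweedler_apply, rho_zip n, act_apply, σ.smul_act]

/-- The same rule in the leading factor only, which is where the cyclic operator places m₍₋₁₎ before
rotating. -/
theorem zip_head (n : ℕ) (h : H) (x : TPow k C (n + 1)) (y : TPow k A (n + 1)) :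
    zip σ.act (n + 1) (head (HopfCyclic.act k h) x) y =
      head (HopfCyclic.act k h) (zip σ.act (n + 1) x y) := by
  suffices e : (zip σ.act (n + 1)).comp (head (HopfCyclic.act k h)) =
      (zip σ.act (n + 1)).compr₂ (head (HopfCyclic.act k h)) from LinearMap.congr_fun₂ e x y
  refine ext_cons fun c x => ext_cons fun a y => ?_
  simp only [LinearMap.compr₂_apply, LinearMap.comp_apply, zip_cons, head_cons, act_apply,
    σ.smul_act]

/-! ### Passage to the balanced tensor products -/

variable [AddCommGroup M] [Module k M] [Module Hᵐᵒᵖ M] [IsScalarTower k Hᵐᵒᵖ M]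

variable (M) in
/-- The map `M ⊗ C^{⊗ n} → Hom(A^{⊗ n}, M ⊗_H A^{⊗ n})`, `m ⊗ c ↦ (a ↦ m ⊗ c ▹ a)`. -/
noncomputable def preBalZip (n : ℕ) : M ⊗[k] TPow k C n →ₗ[k] TPow k A n →ₗ[k] Bal k H A M n :=
  TensorProduct.lift <| LinearMap.mk₂ k
    (fun m x => (balRel k H A M n).mkQ ∘ₗ TensorProduct.mk k M _ m ∘ₗ zip σ.act n x)
    (fun m m' x => by ext; simp)
    (fun r m x => by ext; simp)
    (fun m x x' => by ext; simp [TensorProduct.tmul_add])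
    (fun r m x => by ext; simp)

theorem preBalZip_tmul {n : ℕ} (m : M) (x : TPow k C n) (y : TPow k A n) :
    σ.preBalZip M n (m ⊗ₜ x) y = (balRel k H A M n).mkQ (m ⊗ₜ zip σ.act n x y) := rfl

variable (M) in
/-- The map `M ⊗_H C^{⊗ n} → Hom(A^{⊗ n}, M ⊗_H A^{⊗ n})`, `m ⊗ c ↦ (a ↦ m ⊗ c ▹ a)`. -/
noncomputable def balZip (n : ℕ) : Bal k H C M n →ₗ[k] TPow k A n →ₗ[k] Bal k H A M n :=
  -- By `rho_zip`, a relation mh ⊗ x = m ⊗ hx on the C side is carried to a relation of the same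
  -- form on the A side.
  (balRel k H C M n).liftQ (σ.preBalZip M n) <| balRel_le _ fun m h x => LinearMap.ext fun y => by
    rw [preBalZip_tmul, preBalZip_tmul, bal_smul, rho_zip]

/-- The cofaces d_i with i ≤ n and the codegeneracies leave the coefficient untouched, so an
adjunction with respect to `zip` alone carries over to the quotients. It serves for the pairs
(`merge`, `split`) and (`ins`, `del`). -/
theorem balMap_balZip {n m : ℕ} (f : TPow k A m →ₗ[k] TPow k A n) (g : TPow k C n →ₗ[k] TPow k C m)
    (hf hg) (h : ∀ x y, f (zip σ.act m (g x) y) = zip σ.act n x (f y)) (w : Bal k H C M n)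
    (y : TPow k A m) :
    balMap f hf (σ.balZip M m (balMap g hg w) y) = σ.balZip M n w (f y) := by
  obtain ⟨z, rfl⟩ := Submodule.mkQ_surjective _ w
  change balMap f hf (σ.preBalZip M m (LinearMap.lTensor M g z) y) = σ.preBalZip M n z (f y)
  induction z with
  | zero => simp
  | add a b ha hb => simp only [map_add, LinearMap.add_apply, ha, hb]
  | tmul a x =>
    rw [LinearMap.lTensor_tmul, preBalZip_tmul, preBalZip_tmul, ← h]
    rfl

variable (M) in
/-- The pairing `(m ⊗ c) ⊗ φ ↦ (a ↦ φ(m ⊗ c ▹ a))` in degree `n`. -/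
noncomputable def levelPairing (n : ℕ) :
    Bal k H C M (n + 1) ⊗[k] Module.Dual k (Bal k H A M (n + 1)) →ₗ[k]
      Module.Dual k (TPow k A (n + 1)) :=
  TensorProduct.lift ((LinearMap.llcomp k _ _ _).flip ∘ₗ σ.balZip M (n + 1))

/-! ### Compatibility with the cyclic operators -/

variable [SAYDModule k H M]

/-- Rotating c and a together places (m₍₋₁₎c⁰) ▹ a₀ = m₍₋₁₎(c⁰ ▹ a₀) in the last factor, which is
the twisted left rotation of m ⊗ (c ▹ a). Comparing with the left rotation on the A side keeps S⁻¹
out of the computation. -/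
theorem balZip_balCycL (n : ℕ) (w : Bal k H C M (n + 1)) (y : TPow k A (n + 1)) :
    σ.balZip M (n + 1) (balCycL k H C M n w) (rotL n y) =
      balCycL k H A M n (σ.balZip M (n + 1) w y) := by
  obtain ⟨z, rfl⟩ := Submodule.mkQ_surjective _ w
  change σ.preBalZip M (n + 1) (cycL k H C M n z) (rotL n y) =
    balCycL k H A M n (σ.preBalZip M (n + 1) z y)
  induction z with
  | zero => simp
  | add a b ha hb => simp only [map_add, LinearMap.add_apply, ha, hb]
  | tmul m x =>
    rw [preBalZip_tmul]
    change _ = (balRel k H A M (n + 1)).mkQ (cycL k H A M n (m ⊗ₜ zip σ.act (n + 1) x y))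
    simp only [cycL, LinearMap.comp_apply, twist_tmul]
    -- Both sides are linear in the coaction of m, and the equality holds for any element of H ⊗ M
    -- in its place. The anti-Yetter–Drinfeld condition enters only through the fact that the
    -- rotations are defined on the quotients.
    induction (SAYDModule.coact m : H ⊗[k] M) with
    | zero => simp
    | add a b ha hb => simp only [map_add, LinearMap.add_apply, ha, hb]
    | tmul h m =>
      simp only [twistAux_tmul, LinearMap.lTensor_tmul, preBalZip_tmul, LinearMap.comp_apply,
        zip_rotL, zip_head]

/-- The right rotation undoes the left one on M ⊗_H A^{⊗(n+1)}, so it removes the twist produced by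
the C-side operator. What is left is the plain rotation of y, and applying φ gives the compatibility
of Ψ with t. -/
theorem balCycR_balZip (hS : Function.Bijective (HopfAlgebra.antipode k : H →ₗ[k] H)) (n : ℕ)
    (w : Bal k H C M (n + 1)) (y : TPow k A (n + 1)) :
    balCycR A M hS n (σ.balZip M (n + 1) (balCycL k H C M n w) y) =
      σ.balZip M (n + 1) w (rotR n y) := by
  have h1 : rotL n (rotR n y) = y := LinearMap.congr_fun (rotL_rotR (k := k) (V := A) n) y
  have h2 : ∀ x : Bal k H A M (n + 1), balCycR A M hS n (balCycL k H A M n x) = x := fun x => by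
    obtain ⟨z, rfl⟩ := Submodule.mkQ_surjective _ x
    exact congrArg (balRel k H A M (n + 1)).mkQ (cycR_cycL hS n z)
  -- Writing y as the left rotation of `rotR n y` brings the left side into the form of
  -- `balZip_balCycL`.
  conv_lhs => rw [← h1]
  rw [balZip_balCycL, h2]

/-! ### The morphism Ψ -/

variable [HopfModuleCoalgebra k H C] [HopfModuleAlgebra k H A]

variable (M) in
/-- The morphism `Ψ : diag(C^*_H(C, M) ⊗ C^*_H(A, M)) → C^*(A)` of cocyclic modules. -/
noncomputable def diagPairing
    (hS : Function.Bijective (HopfAlgebra.antipode k : H →ₗ[k] H)) :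
    cocyclicCoalg k H C M ⊗ cocyclicAlg A M hS ⟶ cocyclicOrd k A :=
  CocyclicData.pairing (coalgebraData k H C M) (moduleAlgebraData A M hS) (algebraData k A)
    (fun n => σ.levelPairing M n)
    -- The operators on both dual modules are transposes. Evaluated at y, each compatibility is
    -- therefore φ applied to an identity in M ⊗_H A^{⊗•}.
    (fun n i hi w φ => LinearMap.ext fun y =>
      congrArg (DFunLike.coe (F := Module.Dual k (Bal k H A M (_ + 1))) φ) <|
      σ.balMap_balZip (merge n i) (split (n + 1) i)
        (fun h => rho_merge h n i) (fun h => rho_split h (n + 1) i) (σ.merge_zip n i hi) w y)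
    -- The shift to j + 1 is common to both sides: s_j deletes the factor c^{j+1} and inserts the
    -- unit after a_j, both at position j + 1 counted from 0.
    (fun n j hj w φ => LinearMap.ext fun y =>
      congrArg (DFunLike.coe (F := Module.Dual k (Bal k H A M (_ + 1))) φ) <|
      σ.balMap_balZip (ins (n + 1) (j + 1)) (del (n + 1) (j + 1))
        (fun h => rho_ins h (n + 1) (j + 1)) (fun h => rho_del h (n + 1) (j + 1))
        (σ.ins_zip (n + 1) (j + 1) (by omega)) w y)
    (fun n w φ => LinearMap.ext fun y =>
      congrArg (DFunLike.coe (F := Module.Dual k (Bal k H A M (_ + 1))) φ) <|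
      σ.balCycR_balZip hS n w y)

end EquivariantAction

/-! ### The pairing on cyclic cohomology -/

section ExternalProductLinear

variable {k : Type u} [Field k]

/-- The pairing `α ⊗ β ↦ f_*(α × β)` on cyclic cohomology. -/
noncomputable def cupProduct {X Y Z : CocyclicModule k} (f : X ⊗ Y ⟶ Z) (p q : ℕ) :
    HC p X ⊗[k] HC q Y →ₗ[k] HC (p + q) Z :=
  TensorProduct.lift <| LinearMap.mk₂ k (fun α β => HC.map f (extProd α β))
    -- In α the product is a Yoneda composite with fixed classes, so linearity is that of
    -- composition.
    (fun α α' β => by simp [HC.map, extProd, Abelian.Ext.add_comp])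
    (fun r α β => by simp [HC.map, extProd, Abelian.Ext.smul_comp])
    -- In β there is one further ingredient: the map that X ⊗ − induces on Ext is additive and
    -- k-linear, because the functor is.
    (fun α β β' => by
      simp [HC.map, extProd, Abelian.Ext.mapExactFunctor_add, Abelian.Ext.add_comp,
        Abelian.Ext.comp_add])
    (fun r α β => by
      simp [HC.map, extProd, Functor.mapExactFunctor_smul, Abelian.Ext.smul_comp,
        Abelian.Ext.comp_smul])

end ExternalProductLinear

end HopfCyclic

open HopfCyclic
theorem mainTheorem7 {k H C A M : Type u} [Field k] [Ring H] [HopfAlgebra k H]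
    (hS : Function.Bijective (HopfAlgebra.antipode k : H →ₗ[k] H))
    [AddCommGroup C] [Module k C] [Coalgebra k C] [Module H C] [IsScalarTower k H C]
    [HopfModuleCoalgebra k H C]
    [Ring A] [Algebra k A] [Module H A] [IsScalarTower k H A] [HopfModuleAlgebra k H A]
    [AddCommGroup M] [Module k M] [Module Hᵐᵒᵖ M] [IsScalarTower k Hᵐᵒᵖ M] [SAYDModule k H M]
    (σ : EquivariantAction k H C A) :
    ∃ Ψ : cocyclicCoalg k H C M ⊗ cocyclicAlg A M hS ⟶ cocyclicOrd k A,
      (∀ (n : ℕ) (m : M) (c : Fin (n + 1) → C) (φ : Module.Dual k (Bal k H A M (n + 1)))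
        (a : Fin (n + 1) → A),
        level Ψ n (bal m (TPow.pure c) ⊗ₜ[k] φ) (TPow.pure a) =
        φ (bal m (TPow.pure fun i => σ.act (c i) (a i)))) ∧
      ∀ p q : ℕ, ∃ B : HC p (cocyclicCoalg k H C M) ⊗[k] HC q (cocyclicAlg A M hS) →ₗ[k]
          HC (p + q) (cocyclicOrd k A),
        ∀ α β, B (α ⊗ₜ[k] β) = HC.map Ψ (extProd α β) := by
  refine ⟨σ.diagPairing M hS, fun n m c φ a => ?_, fun p q =>
    ⟨cupProduct (σ.diagPairing M hS) p q, fun α β => rfl⟩⟩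
  -- The class of m ⊗ c comes with a representative, on which the component of Ψ at [n] evaluates by
  -- definition to φ of a single `zip`; `zip_pure` then gives the displayed formula.
  change φ (bal m (TPow.zip σ.act (n + 1) (TPow.pure c) (TPow.pure a))) = _
  rw [TPow.zip_pure]
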